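/- \textbf{Setting.} Let $\mathcal T=(S,T,AP,L,w)$ be a finite transition system in which every state has a successor, with positive integer weights $w$ on transitions, let $\mathcal B$ be a finite Büchi automaton over $2^{AP}$ with total transition relation $\delta$ and accepting set $F$, and let $\mathcal P$ be their product: its states are $S\times Q$, there is a transition $(s,q)\to(s',q')$ iff $(s,s')\in T$ and $(q,L(s),q')\in\delta$, labels and weights come from $\mathcal T$, and the accepting states are $S\times F$. Fix $\pi_{\mathrm{sur}}\in AP$; states whose label contains $\pi_{\mathrm{sur}}$ are surveillance states. For a finite run $\sigma$, every visit of a surveillance state after the initial state completes a surveillance cycle, and $\sharp(\sigma)$ is the number of completed surveillance cycles, plus one if the last state of $\sigma$ is not a surveillance state. \textbf{Penalties.} Let $r\ge 1$ be an integer and $p\colon S\to(0,1]$. For each $s$, the penalty $g(s,0)$ is uniform on $\{0,\frac1r,\dots,1\}$; if $g(s,t)<1$ then $g(s,t+1)=g(s,t)+\frac1r$, and if $g(s,t)=1$ then $g(s,t+1)$ is $1$ with probability $p(s)$ and $0$ otherwise, all random choices being independent. The penalty in $(s,q)$ is that in $s$, and $g_{\mathrm{exp}}((s,q))=\frac12(1+p(s))$.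 For a strategy $C$ of $\mathcal P$ and a state $x$ let $\rho$ be the run from $x$ induced by $C$, let $\rho^{(n)}$ be its prefix with $n+1$ states, and let $\Pr_x^{C}$ be the law of the sequence of penalties $g(\rho(i),w(\rho^{(i)}))$, $i\ge0$, incurred along it. Put $$A_n=\frac{\sum_{i=0}^{n} g(\rho(i),w(\rho^{(i)}))}{\sharp(\rho^{(n)})}.$$ \textbf{Optimal value, cycle and strategy.} Let $\mathcal U$ be an accepting strongly connected component of $\mathcal P$ (a maximal strongly connected sub-system containing an accepting state). For a state $x$ of $\mathcal U$ let $V^*_{\mathcal U}(x)$ be the minimum, over all infinite runs $\varrho$ in $\mathcal U$ from $x$, of $\limsup_{n}\sum_{i=0}^n g_{\mathrm{exp}}(\varrho(i))/\sharp(\varrho^{(n)})$. The reduction $\overline{\mathcal U}$ is the graph on the surveillance states of $\mathcal U$ with an edge $(u,u')$ iff there is a finite run in $\mathcal U$, with at least one transition, from $u$ to $u'$ that visits no surveillance state strictly in between; $\mathrm{run}((u,u'))$ is such a run with minimum sum of $g_{\mathrm{exp}}$, with its last state $u'$ removed, and the value of the edge is the sum of $g_{\mathrm{exp}}$ over $\mathrm{run}((u,u'))$.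 Let $u_0\dots u_m$ be a cycle of $\overline{\mathcal U}$ with minimum mean value $\mu$ per edge, and let $\mathsf{cyc}^V_{\mathcal U}=\mathrm{run}((u_0,u_1))\cdots\mathrm{run}((u_{m-1},u_m))\,\mathrm{run}((u_m,u_0))$. Let $C^V$ be a strategy of $\mathcal P$ that follows finite runs of minimum weight to $\mathsf{cyc}^V_{\mathcal U}$ from the states outside it from which it is reachable, and follows the cycle $\mathsf{cyc}^V_{\mathcal U}$ forever once on it. \textbf{Proposition.} Let $x$ be a state of $\mathcal U$ and let $A_n$ be formed with the strategy $C^V$ from $x$. Then $V^*_{\mathcal U}(x)=\mu$; in particular it does not depend on $x$, and we write $V^*_{\mathcal U}$. Moreover: 1. For every $\epsilon>0$, $\lim_{n\to\infty}\Pr_x^{C^V}\big(A_n\le V^*_{\mathcal U}+\epsilon\big)=1$. 2. If some state $(s,q)$ of $\mathsf{cyc}^V_{\mathcal U}$ has $p(s)<1$, then also $\lim_{n\to\infty}\Pr_x^{C^V}\big(A_n\le V^*_{\mathcal U}\big)=1$. 3. For every $\epsilon>0$ there is $j(\epsilon)\in\mathbb N$ such that, for every prefix $\rho^{(n)}$ in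 which at least $j(\epsilon)$ surveillance cycles are completed, $A_n\le V^*_{\mathcal U}+\epsilon$ with probability at least $1-\epsilon$. -/

import Mathlib

open MeasureTheory Filter Topology
open scoped ENNReal

/-- A weighted deterministic transition system with state set `X` and atomic propositions `AP`.
The weight of a transition is a positive number of time units; only the values of `w` on
transitions matter. -/
structure TS (X AP : Type*) where
  T : X → X → Prop
  L : X → Set AP
  w : X → X → ℕ
  total : ∀ x, ∃ y, T x y
  w_pos : ∀ x y, T x y → 0 < w x y

/-- A Büchi automaton with state set `Q` over the alphabet of all subsets of `AP`. -/
structure Buchi (Q AP : Type*) where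
  δ : Q → Set AP → Q → Prop
  total : ∀ q a, ∃ q', δ q a q'
  q₀ : Q
  F : Set Q

/-- The product of a transition system and a Büchi automaton, as a transition system. -/
def TS.product {S Q AP : Type*} (M : TS S AP) (B : Buchi Q AP) : TS (S × Q) AP where
  T x y := M.T x.1 y.1 ∧ B.δ x.2 (M.L x.1) y.2
  L x := M.L x.1
  w x y := M.w x.1 y.1
  total x := by
    obtain ⟨s, hs⟩ := M.total x.1
    obtain ⟨q, hq⟩ := B.total x.2 (M.L x.1)
    exact ⟨(s, q), hs, hq⟩
  w_pos x y h := M.w_pos x.1 y.1 h.1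

namespace TS

variable {X AP : Type*}

/-- The states labelled with the surveillance proposition `sur`. -/
def surStates (P : TS X AP) (sur : AP) : Set X := {x | sur ∈ P.L x}

/-- Finite runs. As every state has a successor, the finite prefixes of runs are exactly the
non-empty finite paths. -/
def IsFinRun (P : TS X AP) (σ : List X) : Prop := σ ≠ [] ∧ σ.IsChain P.T

/-- The weight of a finite run: the sum of the weights of its transitions. -/
def weight (P : TS X AP) : List X → ℕ
  | [] => 0
  | [_] => 0
  | x :: y :: l => P.w x y + weight P (y :: l)

/-- `w^*(x, y)`: the minimum weight of a finite run from `x` to `y` (`⊤` if there is none). -/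
noncomputable def minWeight (P : TS X AP) (x y : X) : ℕ∞ :=
  ⨅ σ ∈ {σ : List X | P.IsFinRun σ ∧ σ.head? = some x ∧ σ.getLast? = some y},
    (P.weight σ : ℕ∞)

/-- `w^*(x, A)`: the minimum of `w^*(x, a)` over `a ∈ A`. -/
noncomputable def minWeightTo (P : TS X AP) (x : X) (A : Set X) : ℕ∞ :=
  ⨅ a ∈ A, P.minWeight x a

/-- The number of surveillance cycles completed in a finite run: the number of visits of
surveillance states after the initial state. -/
noncomputable def completed (P : TS X AP) (sur : AP) (σ : List X) : ℕ := by
  classical exact σ.tail.countP (fun x => decide (x ∈ P.surStates sur))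

/-- `♯σ`: the number of completed surveillance cycles, plus one if the last state of `σ` is not
a surveillance state. -/
noncomputable def cycleCount (P : TS X AP) (sur : AP) (σ : List X) : ℕ := by
  classical exact
    P.completed sur σ + if ∃ x ∈ σ.getLast?, x ∈ P.surStates sur then 0 else 1

/-- A control strategy: it maps every finite run to a successor of its last state.
(The values on lists that are not finite runs are irrelevant.) -/
structure Strategy (P : TS X AP) where
  next : List X → X
  valid : ∀ σ x, P.IsFinRun σ → σ.getLast? = some x → P.T x (next σ)

/-- The finite prefix `ρ^{(n)}`, with `n + 1` states, of the run from `x` induced by `C`. -/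
def Strategy.pre {P : TS X AP} (C : P.Strategy) (x : X) : ℕ → List X
  | 0 => [x]
  | n + 1 => C.pre x n ++ [C.next (C.pre x n)]

/-- The run `ρ` from `x` induced by `C`. -/
def Strategy.run {P : TS X AP} (C : P.Strategy) (x : X) : ℕ → X
  | 0 => x
  | n + 1 => C.next (C.pre x n)

theorem Strategy.pre_eq_map_run {P : TS X AP} (C : P.Strategy) (x : X) (n : ℕ) :
    C.pre x n = (List.range (n + 1)).map (C.run x) := by
  induction n with
  | zero => rfl
  | succ k ih =>
    rw [List.range_succ, List.map_append, ← ih]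
    rfl

/-- A sub-system: a transition system on a subset of the states with some of the transitions. -/
structure SubSystem (P : TS X AP) where
  states : Set X
  trans : X → X → Prop
  nonempty : states.Nonempty
  trans_T : ∀ x y, trans x y → P.T x y
  trans_mem : ∀ x y, trans x y → x ∈ states ∧ y ∈ states
  total : ∀ x ∈ states, ∃ y, trans x y

/-- `U` is contained in `W`. -/
def SubSystem.Contained {P : TS X AP} (U W : P.SubSystem) : Prop :=
  U.states ⊆ W.states ∧ ∀ x y, U.trans x y → W.trans x y

/-- Strong connectedness: from every state of `U` there is a finite run in `U` to every state. -/
def SubSystem.StronglyConnected {P : TS X AP} (U : P.SubSystem) : Prop :=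
  ∀ x ∈ U.states, ∀ y ∈ U.states, Relation.ReflTransGen U.trans x y

/-- Strongly connected components: maximal strongly connected sub-systems. -/
def SubSystem.IsSCC {P : TS X AP} (U : P.SubSystem) : Prop :=
  U.StronglyConnected ∧
    ∀ W : P.SubSystem, W.StronglyConnected → U.Contained W → W.Contained U

/-- The surveillance states of `U`. -/
def SubSystem.sur {P : TS X AP} (U : P.SubSystem) (sur : AP) : Set X :=
  U.states ∩ P.surStates sur

/-- `σ` is a finite run in `U` from the surveillance state `u` to the surveillance state `u'`
with exactly one surveillance cycle, i.e. with no surveillance state strictly in between. -/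
def SubSystem.IsOneCycleRun {P : TS X AP} (U : P.SubSystem) (sur : AP) (u u' : X)
    (σ : List X) : Prop :=
  u ∈ U.sur sur ∧ u' ∈ U.sur sur ∧
    ∃ mid : List X, σ = u :: (mid ++ [u']) ∧ (∀ x ∈ mid, x ∉ P.surStates sur) ∧
      σ.IsChain U.trans

/-- The transitions of the reduction of `U` to its surveillance states. -/
def SubSystem.redTrans {P : TS X AP} (U : P.SubSystem) (sur : AP) (u u' : X) : Prop :=
  ∃ σ, U.IsOneCycleRun sur u u' σ

/-- `run` assigns to every transition `(u, u')` of the reduction a finite run `u = u₀ … uₙ` such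
that `u₀ … uₙ u'` minimizes the expected sum of penalties, given by `e` state by state, among all
finite runs in `U` from `u` to `u'` with one surveillance cycle. -/
def SubSystem.IsRunMap {P : TS X AP} (U : P.SubSystem) (sur : AP) (e : X → ℝ)
    (run : X → X → List X) : Prop :=
  ∀ u u', U.redTrans sur u u' →
    U.IsOneCycleRun sur u u' (run u u' ++ [u']) ∧
      ∀ σ, U.IsOneCycleRun sur u u' σ → ((run u u' ++ [u']).map e).sum ≤ (σ.map e).sum

/-- `u₀ … u_m` is a cycle of the reduction of `U`. The addition in `Fin (m + 1)` is modulo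
`m + 1`. -/
def SubSystem.IsRedCycle {P : TS X AP} (U : P.SubSystem) (sur : AP) {m : ℕ}
    (u : Fin (m + 1) → X) : Prop :=
  ∀ i, U.redTrans sur (u i) (u (i + 1))

/-- The mean value per edge of a cycle, an edge `(u, u')` of the reduction having the value
`∑ e (run (u, u'))`. -/
noncomputable def cycleMean (e : X → ℝ) (run : X → X → List X) {m : ℕ}
    (u : Fin (m + 1) → X) : ℝ :=
  (∑ i, ((run (u i) (u (i + 1))).map e).sum) / (m + 1 : ℝ)

/-- `u` is a minimum mean cycle of the reduction of `U`. -/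
def SubSystem.IsMinMeanCycle {P : TS X AP} (U : P.SubSystem) (sur : AP) (e : X → ℝ)
    (run : X → X → List X) {m : ℕ} (u : Fin (m + 1) → X) : Prop :=
  U.IsRedCycle sur u ∧
    ∀ (k : ℕ) (v : Fin (k + 1) → X), U.IsRedCycle sur v → cycleMean e run u ≤ cycleMean e run v

/-- The cycle of `U` obtained from a cycle of the reduction:
`run(u₀,u₁) . … . run(u_{m-1},u_m) . run(u_m,u₀)`. -/
def expandCycle (run : X → X → List X) {m : ℕ} (u : Fin (m + 1) → X) : List X :=
  (List.ofFn fun i => run (u i) (u (i + 1))).flatten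

/-- `V^*_U(x)`: the minimum, over all infinite runs in `U` from `x` (that is, over everything that
strategies can induce inside `U`), of the average cumulative penalty per surveillance cycle, with
the expected penalty in a state given by `e`. The value of a run is `⊤` if it visits surveillance
states only finitely often and `e` is bounded below by a positive number. -/
noncomputable def SubSystem.optValue {P : TS X AP} (U : P.SubSystem) (sur : AP) (e : X → ℝ)
    (x : X) : ℝ≥0∞ :=
  ⨅ ρ ∈ {ρ : ℕ → X | ρ 0 = x ∧ ∀ i, U.trans (ρ i) (ρ (i + 1))},
    limsup (fun n : ℕ =>
      ENNReal.ofReal (∑ i ∈ Finset.range (n + 1), e (ρ i)) /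
        (P.cycleCount sur ((List.range (n + 1)).map ρ) : ℝ≥0∞)) atTop

/-- `C` is a strategy for the average subgoal given by the cycle `cyc = c₀ … c_m`. Off the cycle it
follows a finite run of minimum weight to the cycle. On the cycle it moves from `c_k` to `c_{k+1}`
(indices modulo the length); as a state may occur several times on the cycle, the current index
`k` is a memory `pos`, which is chosen arbitrarily among the occurrences of the current state when
the cycle is entered and then advances by one in each step. -/
def Strategy.IsAverageStrategy {P : TS X AP} (C : P.Strategy) (cyc : List X) : Prop :=
  (∀ σ x, P.IsFinRun σ → σ.getLast? = some x → x ∉ cyc → P.minWeightTo x {y | y ∈ cyc} < ⊤ →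
    P.minWeightTo x {y | y ∈ cyc} =
      (P.w x (C.next σ) : ℕ∞) + P.minWeightTo (C.next σ) {y | y ∈ cyc}) ∧
  ∃ pos : List X → ℕ, ∀ σ x, P.IsFinRun σ → σ.getLast? = some x → x ∈ cyc →
    cyc[pos σ]? = some x ∧
    cyc[(pos σ + 1) % cyc.length]? = some (C.next σ) ∧
    pos (σ ++ [C.next σ]) = (pos σ + 1) % cyc.length

end TS

/-- Accepting strongly connected components of a product. -/
def IsASCC {S Q AP : Type*} {M : TS S AP} {B : Buchi Q AP} (U : (M.product B).SubSystem) : Prop :=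
  U.IsSCC ∧ (U.states ∩ {x | x.2 ∈ B.F}).Nonempty

section Penalties

variable {S : Type*}

/-- The expected penalty `(1 - p(s)) * ½ + p(s) * 1 = ½ (1 + p(s))` assigned to the state `s`. -/
noncomputable def penExp (p : S → Set.Ioc (0 : ℝ) 1) (s : S) : ℝ := (1 + (p s : ℝ)) / 2

/-- The law of a coin that is `true` with probability `a`. -/
noncomputable def coinLaw (a : Set.Ioc (0 : ℝ) 1) : Measure Bool :=
  ENNReal.ofReal (a : ℝ) • Measure.dirac true + ENNReal.ofReal (1 - (a : ℝ)) • Measure.dirac false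

instance coinLaw_isProbabilityMeasure (a : Set.Ioc (0 : ℝ) 1) :
    IsProbabilityMeasure (coinLaw a) where
  measure_univ := by
    have h0 := a.2.1
    have h1 := a.2.2
    simp only [coinLaw, Measure.add_apply, Measure.smul_apply, measure_univ, smul_eq_mul, mul_one]
    rw [← ENNReal.ofReal_add h0.le (by linarith)]
    simp

/-- The randomness of the penalties: for every state an initial level in `{0, …, r}`, and for every
state and time a coin that decides whether a penalty equal to `1` at that time remains `1`. -/
abbrev PenaltySpace (S : Type*) (r : ℕ) : Type _ := (S → Fin (r + 1)) × (S × ℕ → Bool)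

/-- All initial levels are uniform, the coins of `s` are `true` with probability `p s`, and
everything is independent. -/
noncomputable def penaltyLaw (r : ℕ) (p : S → Set.Ioc (0 : ℝ) 1) : Measure (PenaltySpace S r) :=
  (Measure.infinitePi fun _ : S => (PMF.uniformOfFintype (Fin (r + 1))).toMeasure).prod
    (Measure.infinitePi fun i : S × ℕ => coinLaw (p i.1))

/-- `r` times the penalty in `s` at time `t`. -/
def penaltyLevel {r : ℕ} (ω : PenaltySpace S r) (s : S) : ℕ → ℕ
  | 0 => ω.1 s
  | t + 1 =>
    if penaltyLevel ω s t < r then penaltyLevel ω s t + 1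
    else if ω.2 (s, t) then r else 0

/-- The penalty `g(s, t) ∈ {0, 1/r, …, 1}`. -/
noncomputable def penalty {r : ℕ} (ω : PenaltySpace S r) (s : S) (t : ℕ) : ℝ :=
  (penaltyLevel ω s t : ℝ) / (r : ℝ)

theorem measurable_penaltyLevel {r : ℕ} (s : S) (t : ℕ) :
    Measurable fun ω : PenaltySpace S r => penaltyLevel ω s t := by
  induction t with
  | zero =>
    have h : Measurable fun ω : PenaltySpace S r => ω.1 s :=
      (measurable_pi_apply s).comp measurable_fst
    exact (measurable_of_finite (fun a : Fin (r + 1) => (a : ℕ))).comp h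
  | succ k ih =>
    have h : Measurable fun ω : PenaltySpace S r => ω.2 (s, k) :=
      (measurable_pi_apply (s, k)).comp measurable_snd
    simp only [penaltyLevel]
    exact Measurable.ite (ih measurableSet_Iio) (ih.add_const 1)
      (Measurable.ite (h (measurableSet_singleton true)) measurable_const measurable_const)

theorem measurable_penalty {r : ℕ} (s : S) (t : ℕ) :
    Measurable fun ω : PenaltySpace S r => penalty ω s t :=
  (measurable_from_top.comp (measurable_penaltyLevel s t)).div_const _

variable {Q AP : Type*} {M : TS S AP} {B : Buchi Q AP}

/-- The sequence of penalties incurred along the run from `x` induced by the strategy `C` of the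
product: the `i`-th one is `g(ρ(i), w(ρ^{(i)}))`, the penalty in `(s, q)` being that in `s`. -/
noncomputable def incurred {r : ℕ} (C : (M.product B).Strategy) (x : S × Q)
    (ω : PenaltySpace S r) (i : ℕ) : ℝ :=
  penalty ω (C.run x i).1 ((M.product B).weight (C.pre x i))

theorem measurable_incurred {r : ℕ} (C : (M.product B).Strategy) (x : S × Q) :
    Measurable (incurred (r := r) C x) :=
  measurable_pi_lambda _ fun _ => measurable_penalty _ _

/-- `Pr_x^C`: the law of the infinite sequence of penalties received in the visited states under
the strategy `C` started in `x`. -/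
noncomputable def pathLaw (r : ℕ) (p : S → Set.Ioc (0 : ℝ) 1) (C : (M.product B).Strategy)
    (x : S × Q) : Measure (ℕ → ℝ) :=
  (penaltyLaw r p).map (incurred C x)

instance pathLaw_isProbabilityMeasure (r : ℕ) (p : S → Set.Ioc (0 : ℝ) 1)
    (C : (M.product B).Strategy) (x : S × Q) : IsProbabilityMeasure (pathLaw r p C x) := by
  have : IsProbabilityMeasure (penaltyLaw r p) := by unfold penaltyLaw; infer_instance
  exact Measure.isProbabilityMeasure_map (measurable_incurred C x).aemeasurable

/-- The average cumulative penalty per surveillance cycle of the finite run `ρ^{(n)}`, for the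
sequence `κ` of incurred penalties. -/
noncomputable def averagePenalty (sur : AP) (C : (M.product B).Strategy) (x : S × Q) (n : ℕ)
    (κ : ℕ → ℝ) : ℝ :=
  (∑ i ∈ Finset.range (n + 1), κ i) / ((M.product B).cycleCount sur (C.pre x n) : ℝ)

end Penalties

/-! The value of a state. Two visits of a run in `U` to the same surveillance state enclose a closed
walk of the reduction, whose penalty is at least μ per edge. As there are finitely many states, a
run with infinitely many surveillance visits returns to one such state infinitely often, so its
limsup is at least μ; with finitely many visits the quotient is unbounded (`cycleMean_le_optValue`).
Strong connectedness gives a run that reaches the minimum mean cycle and stays on it, and this run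
attains μ (`optValue_le_cycleMean`).

The probabilities. The level of the penalty in a state with parameter q is a finite Markov chain,
and it converges to its stationary law from every initial level. The stationary mean of the penalty
is at most (1 + q)/2, with strict inequality for q < 1 (`meanPenalty_le`, `meanPenalty_lt`). So the
expected penalty used to define μ never underestimates the long-run mean, and this is why claim 2
needs no ε. Penalties collected at distant times are almost uncorrelated, so Chebyshev's inequality
gives a weak law of large numbers that is uniform in the sequence of visited states
(`exists_penaltyLaw_sum_le`). Under the strategy the run ends up on the cycle, where sums of state
functions and the number of surveillance cycles are linear up to a bounded error. Hence the weak law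
bounds the average as soon as the stationary means on the cycle are below the threshold per
surveillance state (`eventually_le_pathLaw_averagePenalty`). -/

/-! ### Sums along runs that end up on a cycle -/

/-- `ρ` eventually goes around the cycle `cyc` forever. -/
def EventuallyFollows {X : Type*} (ρ : ℕ → X) (cyc : List X) : Prop :=
  ∃ K k : ℕ, ∀ i, cyc[(k + i) % cyc.length]? = some (ρ (K + i))

/-- The partial sums are themselves periodic, so they take finitely many values. -/
theorem Function.Periodic.exists_abs_sum_range_le {b : ℕ → ℝ} {L : ℕ} (hL : 0 < L)
    (hb : Function.Periodic b L) (h0 : ∑ i ∈ Finset.range L, b i = 0) :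
    ∃ D, ∀ n, |∑ i ∈ Finset.range n, b i| ≤ D := by
  have hG : Function.Periodic (fun n => ∑ i ∈ Finset.range n, b i) L := by
    intro n
    simp only
    rw [add_comm n L, Finset.sum_range_add, h0, zero_add]
    refine Finset.sum_congr rfl fun i _ => ?_
    rw [add_comm]; exact hb i
  refine ⟨∑ j ∈ Finset.range L, |∑ i ∈ Finset.range j, b i|, fun n => ?_⟩
  rw [← hG.map_mod_nat n]
  exact Finset.single_le_sum (f := fun j => |∑ i ∈ Finset.range j, b i|)
    (fun _ _ => abs_nonneg _) (Finset.mem_range.2 (Nat.mod_lt _ hL))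

theorem EventuallyFollows.length_pos {X : Type*} {ρ : ℕ → X} {cyc : List X}
    (hρ : EventuallyFollows ρ cyc) : 0 < cyc.length := by
  obtain ⟨K, k, h⟩ := hρ
  by_contra hc
  have := h 0
  rw [List.length_eq_zero_iff.1 (Nat.eq_zero_of_not_pos hc)] at this
  simp at this

/-- Once on the cycle, the deviations from the average form a periodic sequence with sum zero over a
period. The error is therefore bounded, not merely o(n). -/
theorem EventuallyFollows.exists_abs_sum_sub_le {X : Type*} {ρ : ℕ → X} {cyc : List X}
    (hρ : EventuallyFollows ρ cyc) (h : X → ℝ) :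
    ∃ D, ∀ n : ℕ, |∑ i ∈ Finset.range n, h (ρ i) - (cyc.map h).sum / cyc.length * n| ≤ D := by
  have hL := hρ.length_pos
  obtain ⟨K, k, hK⟩ := hρ
  set L := cyc.length with hLdef
  set a : ℝ := (cyc.map h).sum / L with ha
  -- The default 0 is never taken, since `j % L` is a valid index.
  let b : ℕ → ℝ := fun j => ((cyc[j % L]?).map h).getD 0 - a
  have hb : Function.Periodic b L := by intro j; simp [b]
  have hb0 : ∑ i ∈ Finset.range L, b i = 0 := by
    have h1 : ∑ i ∈ Finset.range L, ((cyc[i % L]?).map h).getD 0 = (cyc.map h).sum := by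
      rw [Finset.sum_range, ← Fin.sum_univ_fun_getElem cyc h]
      refine Finset.sum_congr rfl fun i _ => ?_
      rw [Nat.mod_eq_of_lt i.2, List.getElem?_eq_getElem i.2]
      rfl
    simp only [b, Finset.sum_sub_distrib, h1, Finset.sum_const, Finset.card_range, nsmul_eq_mul, ha]
    have : (L : ℝ) ≠ 0 := by positivity
    field_simp
    ring
  obtain ⟨D, hD⟩ := hb.exists_abs_sum_range_le hL hb0
  have hbρ : ∀ i, h (ρ (K + i)) - a = b (k + i) := by intro i; simp [b, hK i]
  have key : ∀ n : ℕ, ∑ i ∈ Finset.range n, h (ρ i) - a * n =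
      ∑ i ∈ Finset.range n, (h (ρ i) - a) := by
    intro n
    simp [Finset.sum_sub_distrib, mul_comm]
  -- The first sum pays for the time before the cycle. A block starting at phase `k` is a difference
  -- of two partial sums of `b`, whence `D + D`.
  refine ⟨∑ i ∈ Finset.range K, |h (ρ i) - a| + (D + D), fun n => ?_⟩
  rw [key]
  have hD0 : 0 ≤ D := (abs_nonneg _).trans (hD 0)
  rcases le_total n K with hn | hn
  · calc _ ≤ ∑ i ∈ Finset.range n, |h (ρ i) - a| := Finset.abs_sum_le_sum_abs _ _
      _ ≤ ∑ i ∈ Finset.range K, |h (ρ i) - a| :=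
        Finset.sum_le_sum_of_subset_of_nonneg (by simpa using hn) fun _ _ _ => abs_nonneg _
      _ ≤ _ := by linarith
  · obtain ⟨j, rfl⟩ := Nat.exists_eq_add_of_le hn
    rw [Finset.sum_range_add, Finset.sum_congr rfl fun i _ => hbρ i]
    have h2 := Finset.sum_range_add b k j
    have h3 := Finset.abs_sum_le_sum_abs (fun i => h (ρ i) - a) (Finset.range K)
    have h4 := hD k
    have h5 := hD (k + j)
    rw [h2] at h5
    rw [abs_le] at *
    constructor <;> linarith

/-! ### Counting surveillance cycles; runs induced by strategies -/

namespace TS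

variable {X AP : Type*}

open Classical in
/-- The real-valued indicator of the surveillance states. -/
noncomputable def surInd (P : TS X AP) (sur : AP) (x : X) : ℝ :=
  if x ∈ P.surStates sur then 1 else 0

theorem surInd_nonneg (P : TS X AP) (sur : AP) (x : X) : 0 ≤ P.surInd sur x := by
  unfold surInd; split <;> norm_num

theorem surInd_le_one (P : TS X AP) (sur : AP) (x : X) : P.surInd sur x ≤ 1 := by
  unfold surInd; split <;> norm_num

open Classical in
theorem countP_sur (P : TS X AP) (sur : AP) (l : List X) :
    ((l.countP fun x => decide (x ∈ P.surStates sur) : ℕ) : ℝ) = (l.map (P.surInd sur)).sum := by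
  induction l with
  | nil => simp
  | cons x l ih =>
    rw [List.countP_cons, List.map_cons, List.sum_cons, Nat.cast_add, ih, surInd]
    by_cases hx : x ∈ P.surStates sur <;> simp [hx, add_comm]

theorem completed_map_range (P : TS X AP) (sur : AP) (ρ : ℕ → X) (n : ℕ) :
    (P.completed sur ((List.range (n + 1)).map ρ) : ℝ) =
      ∑ i ∈ Finset.range (n + 1), P.surInd sur (ρ i) - P.surInd sur (ρ 0) := by
  classical
  rw [Finset.sum_range_succ', add_sub_cancel_right, List.range_succ_eq_map]
  have : P.completed sur ((0 :: (List.range n).map Nat.succ).map ρ) =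
      ((List.range n).map fun i => ρ (i + 1)).countP fun x => decide (x ∈ P.surStates sur) := by
    unfold completed
    simp [Function.comp_def]
  rw [this, countP_sur, List.map_map]
  rfl

/-- Needed for claim 3: many completed cycles force a long prefix. -/
theorem completed_map_range_le (P : TS X AP) (sur : AP) (ρ : ℕ → X) (n : ℕ) :
    P.completed sur ((List.range (n + 1)).map ρ) ≤ n := by
  classical
  unfold completed
  refine List.countP_le_length.trans ?_
  simp

/-- The count differs from the number of surveillance visits by at most one: the initial state is
not counted, and an unfinished cycle adds one. -/
theorem cycleCount_map_range_lower (P : TS X AP) (sur : AP) (ρ : ℕ → X) (n : ℕ) :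
    ∑ i ∈ Finset.range (n + 1), P.surInd sur (ρ i) - 1 ≤
      (P.cycleCount sur ((List.range (n + 1)).map ρ) : ℝ) := by
  classical
  have h1 := P.completed_map_range sur ρ n
  have h2 := P.surInd_le_one sur (ρ 0)
  unfold cycleCount
  split_ifs <;> push_cast <;> linarith

theorem cycleCount_map_range_upper (P : TS X AP) (sur : AP) (ρ : ℕ → X) (n : ℕ) :
    (P.cycleCount sur ((List.range (n + 1)).map ρ) : ℝ) ≤
      ∑ i ∈ Finset.range (n + 1), P.surInd sur (ρ i) + 1 := by
  classical
  have h1 := P.completed_map_range sur ρ n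
  have h2 := P.surInd_nonneg sur (ρ 0)
  unfold cycleCount
  split_ifs <;> push_cast <;> linarith

theorem weight_concat (P : TS X AP) (l : List X) (x y : X) (h : l.getLast? = some x) :
    P.weight (l ++ [y]) = P.weight l + P.w x y := by
  induction l with
  | nil => simp at h
  | cons a l ih =>
    cases l with
    | nil => simp at h; subst h; simp [weight]
    | cons b l =>
      have := ih (by simpa using h)
      simp only [List.cons_append, weight] at this ⊢
      rw [this, add_assoc]

namespace Strategy

variable {P : TS X AP} (C : P.Strategy) (x : X)

theorem getLast?_pre (n : ℕ) : (C.pre x n).getLast? = some (C.run x n) := by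
  cases n <;> simp [pre, run]

theorem isFinRun_pre (n : ℕ) : P.IsFinRun (C.pre x n) := by
  induction n with
  | zero => simp [pre, IsFinRun]
  | succ n ih =>
    refine ⟨by simp [pre], ?_⟩
    rw [pre, List.isChain_append]
    refine ⟨ih.2, by simp, ?_⟩
    intro a ha b hb
    rw [List.head?_cons, Option.mem_some_iff] at hb
    exact hb ▸ C.valid _ _ ih ha

theorem run_T (n : ℕ) : P.T (C.run x n) (C.run x (n + 1)) :=
  C.valid _ _ (C.isFinRun_pre x n) (C.getLast?_pre x n)

theorem weight_pre_strictMono : StrictMono fun n => P.weight (C.pre x n) := by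
  refine strictMono_nat_of_lt_succ fun n => ?_
  simp only [pre]
  rw [P.weight_concat _ _ _ (C.getLast?_pre x n)]
  exact Nat.lt_add_of_pos_right (P.w_pos _ _ (C.run_T x n))

/-- An average strategy reaches its cycle and then follows it forever. -/
theorem IsAverageStrategy.eventuallyFollows {C : P.Strategy} {cyc : List X}
    (hC : C.IsAverageStrategy cyc) (hx : P.minWeightTo x {y | y ∈ cyc} < ⊤) :
    EventuallyFollows (C.run x) cyc := by
  obtain ⟨hoff, pos, hpos⟩ := hC
  have hreach : ∃ K, C.run x K ∈ cyc := by
    -- Strong induction on the distance to the cycle, which drops by a positive weight with every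
    -- transition.
    have key : ∀ (k n : ℕ), P.minWeightTo (C.run x n) {y | y ∈ cyc} = k →
        ∃ K, C.run x K ∈ cyc := by
      intro k
      induction k using Nat.strong_induction_on with
      | _ k ih =>
        intro n hn
        by_cases hmem : C.run x n ∈ cyc
        · exact ⟨n, hmem⟩
        have h1 := hoff _ _ (C.isFinRun_pre x n) (C.getLast?_pre x n) hmem
          (by rw [hn]; exact ENat.natCast_lt_top k)
        have hw := P.w_pos _ _ (C.run_T x n)
        change _ = (P.w (C.run x n) (C.run x (n + 1)) : ℕ∞) +
          P.minWeightTo (C.run x (n + 1)) {y | y ∈ cyc} at h1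
        rw [hn] at h1
        cases hj : P.minWeightTo (C.run x (n + 1)) {y | y ∈ cyc} with
        | top => simp [hj] at h1
        | coe j =>
          rw [hj] at h1
          have h2 : k = P.w (C.run x n) (C.run x (n + 1)) + j := by exact_mod_cast h1
          exact ih j (by omega) (n + 1) hj
    obtain ⟨k, hk⟩ := ENat.ne_top_iff_exists.1 hx.ne
    exact key k 0 hk.symm
  obtain ⟨K, hK⟩ := hreach
  have hmem : ∀ i, C.run x (K + i) ∈ cyc := by
    intro i
    induction i with
    | zero => exact hK
    | succ i ih =>
      exact List.mem_of_getElem? (hpos _ _ (C.isFinRun_pre x (K + i)) (C.getLast?_pre x _) ih).2.1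
  have hstep : ∀ i, pos (C.pre x (K + i)) % cyc.length =
      (pos (C.pre x K) + i) % cyc.length := by
    intro i
    induction i with
    | zero => rfl
    | succ i ih =>
      have := (hpos _ _ (C.isFinRun_pre x (K + i)) (C.getLast?_pre x _) (hmem i)).2.2
      change pos (C.pre x (K + i + 1)) = _ at this
      rw [← add_assoc, this, Nat.mod_mod, Nat.add_mod, ih, ← Nat.add_mod, add_assoc]
  refine ⟨K, pos (C.pre x K), fun i => ?_⟩
  have h1 := (hpos _ _ (C.isFinRun_pre x (K + i)) (C.getLast?_pre x _) (hmem i)).1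
  rw [← hstep, Nat.mod_eq_of_lt (List.getElem?_eq_some_iff.1 h1).1]
  exact h1

end Strategy

end TS

/-! ### The reduction and the lower bound for the optimal value -/

namespace TS

namespace SubSystem

variable {X AP : Type*} {P : TS X AP} {U : P.SubSystem} {sur : AP} {e : X → ℝ}
  {run : X → X → List X}

theorem redTrans.left_mem {u u' : X} (h : U.redTrans sur u u') : u ∈ U.sur sur := by
  obtain ⟨_, h, _⟩ := h; exact h

theorem IsRunMap.exists_eq_cons (hrun : U.IsRunMap sur e run) {u u' : X}
    (h : U.redTrans sur u u') :
    ∃ mid, run u u' = u :: mid ∧ (∀ x ∈ mid, x ∉ P.surStates sur) ∧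
      (run u u' ++ [u']).IsChain U.trans := by
  obtain ⟨⟨_, _, mid, heq, hmid, hch⟩, _⟩ := hrun u u' h
  rw [← List.cons_append] at heq
  exact ⟨mid, List.append_cancel_right heq, hmid, hch⟩

/-- The final state is removed and the interior avoids surveillance states, so only the head counts.
Thus each edge of the reduction stands for one surveillance cycle. -/
theorem IsRunMap.sum_surInd (hrun : U.IsRunMap sur e run) {u u' : X}
    (h : U.redTrans sur u u') : ((run u u').map (P.surInd sur)).sum = 1 := by
  obtain ⟨mid, heq, hmid, _⟩ := hrun.exists_eq_cons h
  have h0 : (mid.map (P.surInd sur)).sum = 0 := by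
    refine List.sum_eq_zero fun a ha => ?_
    obtain ⟨x, hx, rfl⟩ := List.mem_map.1 ha
    simp [surInd, hmid x hx]
  rw [heq, List.map_cons, List.sum_cons, h0, add_zero, surInd, if_pos h.left_mem.2]

theorem sum_map_expandCycle (run : X → X → List X) {m : ℕ} (u : Fin (m + 1) → X) (h : X → ℝ) :
    ((expandCycle run u).map h).sum = ∑ i, ((run (u i) (u (i + 1))).map h).sum := by
  rw [expandCycle, List.map_flatten, List.sum_flatten, List.map_map, List.map_ofFn, List.sum_ofFn]
  rfl

theorem IsRunMap.sum_surInd_expandCycle (hrun : U.IsRunMap sur e run) {m : ℕ}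
    {u : Fin (m + 1) → X} (hu : U.IsRedCycle sur u) :
    ((expandCycle run u).map (P.surInd sur)).sum = m + 1 := by
  rw [sum_map_expandCycle, Finset.sum_congr rfl fun i _ => hrun.sum_surInd (hu i)]
  simp

theorem sum_expandCycle_eq_cycleMean (e : X → ℝ) (run : X → X → List X) {m : ℕ}
    (u : Fin (m + 1) → X) :
    ((expandCycle run u).map e).sum = cycleMean e run u * (m + 1) := by
  rw [sum_map_expandCycle, cycleMean]
  field_simp

theorem IsRunMap.exists_expandCycle_eq_cons (hrun : U.IsRunMap sur e run) {m : ℕ}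
    {u : Fin (m + 1) → X} (hu : U.IsRedCycle sur u) : ∃ l, expandCycle run u = u 0 :: l := by
  obtain ⟨mid, heq, _⟩ := hrun.exists_eq_cons (hu 0)
  rw [expandCycle, List.ofFn_succ, List.flatten_cons, heq]
  exact ⟨_, rfl⟩

/-- Appending `u 0` includes the transition that closes the cycle. -/
theorem IsRunMap.isChain_expandCycle (hrun : U.IsRunMap sur e run) {m : ℕ}
    {u : Fin (m + 1) → X} (hu : U.IsRedCycle sur u) :
    (expandCycle run u ++ [u 0]).IsChain U.trans := by
  have hstep : ∀ i, (run (u i) (u (i + 1))).IsChain U.trans ∧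
      ∀ x ∈ (run (u i) (u (i + 1))).getLast?, U.trans x (u (i + 1)) := by
    intro i
    obtain ⟨_, _, _, h⟩ := hrun.exists_eq_cons (hu i)
    rw [List.isChain_append] at h
    exact ⟨h.1, fun x hx => h.2.2 x hx _ (by simp)⟩
  have hhead : ∀ i, ∀ x ∈ (run (u i) (u (i + 1))).head?, x = u i := by
    intro i x hx
    obtain ⟨_, heq, _⟩ := hrun.exists_eq_cons (hu i)
    rw [heq] at hx
    simpa using hx.symm
  have hnil : [] ∉ List.ofFn fun i => run (u i) (u (i + 1)) := by
    intro h
    obtain ⟨i, hi⟩ := List.mem_ofFn.1 h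
    obtain ⟨_, heq, _⟩ := hrun.exists_eq_cons (hu i)
    simp [heq] at hi
  have hlast : (expandCycle run u).getLast? = (run (u (Fin.last m)) (u (Fin.last m + 1))).getLast? := by
    obtain ⟨_, heq, _⟩ := hrun.exists_eq_cons (hu (Fin.last m))
    rw [expandCycle, List.ofFn_succ', List.concat_eq_append, List.flatten_append, List.flatten_singleton,
      heq, List.getLast?_append_of_ne_nil _ (by simp)]
  rw [List.isChain_append]
  refine ⟨?_, by simp, ?_⟩
  · rw [expandCycle, List.isChain_flatten hnil]
    refine ⟨?_, ?_⟩
    · intro l hl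
      obtain ⟨i, rfl⟩ := List.mem_ofFn.1 hl
      exact (hstep i).1
    · rw [List.isChain_ofFn]
      intro i hi x hx y hy
      have hadd : (⟨i, Nat.lt_of_succ_lt hi⟩ : Fin (m + 1)) + 1 = ⟨i + 1, hi⟩ := by
        apply Fin.ext
        rw [Fin.val_add_one_of_lt]
        simp [Fin.lt_def]; omega
      have h1 := (hstep ⟨i, Nat.lt_of_succ_lt hi⟩).2 x hx
      rw [hhead _ y hy, ← hadd]
      exact h1
  · intro x hx y hy
    rw [hlast] at hx
    have := (hstep (Fin.last m)).2 x hx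
    rw [Fin.last_add_one] at this
    simp at hy
    exact hy ▸ this

/-- From every state of a strongly connected sub-system there is an infinite run in it that
eventually goes around a given cycle. -/
theorem StronglyConnected.exists_run_eventuallyFollows (hU : U.StronglyConnected)
    (hrun : U.IsRunMap sur e run) {m : ℕ} {u : Fin (m + 1) → X} (hu : U.IsRedCycle sur u)
    {x : X} (hx : x ∈ U.states) :
    ∃ ρ : ℕ → X, ρ 0 = x ∧ (∀ i, U.trans (ρ i) (ρ (i + 1))) ∧
      EventuallyFollows ρ (expandCycle run u) := by
  have hch := hrun.isChain_expandCycle hu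
  obtain ⟨l, hl⟩ := hrun.exists_expandCycle_eq_cons hu
  -- Induction along this path from its end: the base case goes around the cycle from `u 0`, and
  -- prepending a state only delays the entry by one.
  have hpath := hU x hx (u 0) (hu 0).left_mem.1
  induction hpath using Relation.ReflTransGen.head_induction_on with
  | refl =>
    set cyc := expandCycle run u with hcyc
    have hL : 0 < cyc.length := by rw [hl]; simp
    refine ⟨fun i => cyc[i % cyc.length]'(Nat.mod_lt _ hL), ?_, fun i => ?_, 0, 0, fun i => ?_⟩
    · simp [hl]
    · rw [List.isChain_iff_getElem] at hch
      have hlt := Nat.mod_lt i hL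
      have h1 := hch (i % cyc.length) (by simp; omega)
      rw [List.getElem_append_left hlt] at h1
      rcases Nat.lt_or_ge (i % cyc.length + 1) cyc.length with h2 | h2
      · rw [List.getElem_append_left h2] at h1
        have h3 : (i + 1) % cyc.length = i % cyc.length + 1 := by
          rw [Nat.add_mod, Nat.mod_eq_of_lt (a := 1) (by omega), Nat.mod_eq_of_lt h2]
        simpa only [h3] using h1
      · rw [List.getElem_append_right h2] at h1
        have h3 : (i + 1) % cyc.length = 0 := by
          rw [← Nat.mod_add_mod, show i % cyc.length + 1 = cyc.length by omega, Nat.mod_self]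
        simp only [List.getElem_singleton] at h1
        simp only [h3]
        simpa [hl] using h1
    · simp [List.getElem?_eq_getElem (Nat.mod_lt i hL)]
  | @head a _ hab _ ih =>
    obtain ⟨ρ, h0, hρ, K, k, hK⟩ := ih (U.trans_mem _ _ hab).2
    refine ⟨fun i => Nat.casesOn (motive := fun _ => X) i a ρ, rfl, fun i => ?_, K + 1, k, fun i => ?_⟩
    · cases i with
      | zero => simpa [h0] using hab
      | succ i => exact hρ i
    · rw [hK i, add_right_comm]

/-- The segment of `ρ` competes in the minimization defining `run`. The final state contributes to
both sides and cancels. -/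
theorem IsRunMap.sum_le_sum_Ico (hrun : U.IsRunMap sur e run) {ρ : ℕ → X}
    (hρ : ∀ i, U.trans (ρ i) (ρ (i + 1))) {a b : ℕ} (hab : a < b) (ha : ρ a ∈ P.surStates sur)
    (hb : ρ b ∈ P.surStates sur) (hmid : ∀ i, a < i → i < b → ρ i ∉ P.surStates sur) :
    U.redTrans sur (ρ a) (ρ b) ∧
      ((run (ρ a) (ρ b)).map e).sum ≤ ∑ i ∈ Finset.Ico a b, e (ρ i) := by
  obtain ⟨k, rfl⟩ : ∃ k, b = a + (k + 1) := ⟨b - a - 1, by omega⟩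
  have hone : U.IsOneCycleRun sur (ρ a) (ρ (a + (k + 1)))
      ((List.range (k + 2)).map fun i => ρ (a + i)) := by
    refine ⟨⟨(U.trans_mem _ _ (hρ _)).1, ha⟩, ⟨(U.trans_mem _ _ (hρ _)).1, hb⟩,
      (List.range k).map fun i => ρ (a + (i + 1)), ?_, ?_, ?_⟩
    · rw [List.range_succ, List.range_succ_eq_map]
      simp [Function.comp_def]
    · intro x hx
      obtain ⟨i, hi, rfl⟩ := List.mem_map.1 hx
      rw [List.mem_range] at hi
      exact hmid _ (by omega) (by omega)
    · rw [List.isChain_map, List.isChain_range_succ]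
      intro i _
      exact hρ (a + i)
  have hred : U.redTrans sur (ρ a) (ρ (a + (k + 1))) := ⟨_, hone⟩
  refine ⟨hred, ?_⟩
  have h1 := (hrun _ _ hred).2 _ hone
  rw [List.map_append, List.sum_append, List.map_map] at h1
  change _ ≤ ∑ i ∈ Finset.range (k + 2), e (ρ (a + i)) at h1
  rw [Finset.sum_range_succ] at h1
  rw [Finset.sum_Ico_eq_sum_range, Nat.add_sub_cancel_left]
  simp at h1
  linarith

/-- The visits between `a i₀` and `a i₁` trace a closed walk of the reduction. `IsRedCycle` does not
ask for distinct vertices, so minimality applies directly, without splitting the walk into simple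
cycles. -/
theorem cycleMean_le_sum_Ico (hrun : U.IsRunMap sur e run) {m : ℕ}
    {u : Fin (m + 1) → X} (hu : U.IsMinMeanCycle sur e run u) {ρ : ℕ → X}
    (hρ : ∀ i, U.trans (ρ i) (ρ (i + 1))) {a : ℕ → ℕ} (ha : StrictMono a)
    (hsur : ∀ j, ρ (a j) ∈ P.surStates sur)
    (hmid : ∀ j i, a j < i → i < a (j + 1) → ρ i ∉ P.surStates sur) {i₀ i₁ : ℕ} (hi : i₀ < i₁)
    (hclosed : ρ (a i₀) = ρ (a i₁)) :
    cycleMean e run u * (i₁ - i₀ : ℝ) ≤ ∑ i ∈ Finset.Ico (a i₀) (a i₁), e (ρ i) := by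
  obtain ⟨k, rfl⟩ : ∃ k, i₁ = i₀ + (k + 1) := ⟨i₁ - i₀ - 1, by omega⟩
  have hedge := fun j => hrun.sum_le_sum_Ico hρ (ha (Nat.lt_succ_self j)) (hsur j) (hsur (j + 1))
    (hmid j)
  let w : Fin (k + 1) → X := fun j => ρ (a (i₀ + j))
  have hw : ∀ j : Fin (k + 1), w (j + 1) = ρ (a (i₀ + j + 1)) := by
    intro j
    rcases eq_or_ne j (Fin.last k) with rfl | hj
    · rw [Fin.last_add_one]
      simpa [w, add_assoc] using hclosed
    · simp only [w]
      rw [Fin.val_add_one_of_lt (Fin.lt_last_iff_ne_last.2 hj), add_assoc]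
  have hcyc : U.IsRedCycle sur w := fun j => by
    rw [hw]; exact (hedge (i₀ + j)).1
  have h1 := hu.2 k w hcyc
  have h2 : cycleMean e run w * (k + 1) = ∑ j, ((run (w j) (w (j + 1))).map e).sum := by
    rw [cycleMean]; field_simp
  have h3 : ∑ j : Fin (k + 1), ((run (w j) (w (j + 1))).map e).sum ≤
      ∑ j ∈ Finset.range (k + 1), ∑ i ∈ Finset.Ico (a (i₀ + j)) (a (i₀ + j + 1)), e (ρ i) := by
    rw [Finset.sum_range]
    refine Finset.sum_le_sum fun j _ => ?_
    rw [hw]; exact (hedge (i₀ + j)).2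
  have h4 : ∀ n : ℕ, ∑ j ∈ Finset.range n, ∑ i ∈ Finset.Ico (a (i₀ + j)) (a (i₀ + j + 1)), e (ρ i) =
      ∑ i ∈ Finset.Ico (a i₀) (a (i₀ + n)), e (ρ i) := by
    intro n
    induction n with
    | zero => simp
    | succ n ih =>
      rw [Finset.sum_range_succ, ih, Finset.sum_Ico_consecutive _ (ha.monotone (by omega))
        (ha.monotone (by omega)), add_assoc]
  rw [h4] at h3
  have h5 : cycleMean e run u * (k + 1) ≤ cycleMean e run w * (k + 1) :=
    mul_le_mul_of_nonneg_right h1 (by positivity)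
  push_cast
  rw [add_sub_cancel_left]
  linarith

open Classical in
theorem sum_surInd_eq_count (P : TS X AP) (sur : AP) (ρ : ℕ → X) (n : ℕ) :
    ∑ i ∈ Finset.range n, P.surInd sur (ρ i) =
      (Nat.count (fun i => ρ i ∈ P.surStates sur) n : ℝ) := by
  rw [Nat.count_eq_card_filter_range, Finset.card_filter]
  simp [surInd]

/-- Infinitely many prefixes suffice for a limsup, so only the returns to one fixed surveillance
state need to be examined. -/
theorem frequently_mul_cycleCount_le [Finite X] (hrun : U.IsRunMap sur e run) {m : ℕ}
    {u : Fin (m + 1) → X} (hu : U.IsMinMeanCycle sur e run u) {b : ℝ} (hb : 0 < b)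
    (he : ∀ x, b ≤ e x) {ρ : ℕ → X} (hρ : ∀ i, U.trans (ρ i) (ρ (i + 1))) {c : ℝ} (hc0 : 0 ≤ c)
    (hc : c < cycleMean e run u) :
    ∃ᶠ n in atTop, c * (P.cycleCount sur ((List.range (n + 1)).map ρ) : ℝ) ≤
      ∑ i ∈ Finset.range (n + 1), e (ρ i) := by
  classical
  let p : ℕ → Prop := fun i => ρ i ∈ P.surStates sur
  have hupper := P.cycleCount_map_range_upper sur ρ
  have hlower := P.cycleCount_map_range_lower sur ρ
  have hsum : ∀ n, ∑ i ∈ Finset.range n, P.surInd sur (ρ i) = (Nat.count p n : ℝ) := fun n => by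
    convert sum_surInd_eq_count P sur ρ n
  simp only [hsum] at hupper hlower
  set μ := cycleMean e run u
  by_cases hfin : (Set.ofPred p).Finite
  · refine Eventually.frequently ?_
    have hcount : ∀ n, (Nat.count p n : ℝ) ≤ hfin.toFinset.card := by
      intro n
      rw [Nat.count_eq_card_filter_range]
      exact_mod_cast Finset.card_le_card fun i hi => by
        simpa using (Finset.mem_filter.1 hi).2
    -- Finitely many surveillance visits: the count stays bounded while the sum grows at least like
    -- `b * n`.
    obtain ⟨N, hN⟩ := exists_nat_gt (c * (hfin.toFinset.card + 1) / b)
    filter_upwards [eventually_ge_atTop N] with n hn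
    have h1 : b * (n + 1) ≤ ∑ i ∈ Finset.range (n + 1), e (ρ i) := by
      calc b * (n + 1) = ∑ i ∈ Finset.range (n + 1), b := by simp [mul_comm]
        _ ≤ _ := Finset.sum_le_sum fun i _ => he _
    rw [div_lt_iff₀ hb] at hN
    have h2 : (N : ℝ) ≤ n := by exact_mod_cast hn
    have h3 := mul_le_mul_of_nonneg_left ((hupper n).trans (by linarith [hcount (n + 1)] :
      _ ≤ (hfin.toFinset.card : ℝ) + 1)) hc0
    nlinarith
  · have hinf : (Set.ofPred p).Infinite := hfin
    set a := Nat.nth p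
    have ha : StrictMono a := Nat.nth_strictMono hinf
    obtain ⟨y, hy⟩ := Finite.exists_infinite_fiber fun j => ρ (a j)
    have hyinf : ((fun j => ρ (a j)) ⁻¹' {y}).Infinite := Set.infinite_coe_iff.1 hy
    obtain ⟨i₀, hi₀⟩ := hyinf.nonempty
    -- At time `a i₁` the count is at most `i₁ + 2`, so `c * (i₁ + 2) ≤ μ * (i₁ - i₀)` is needed. As
    -- `c < μ`, it is enough that `i₁ * (μ - c) ≥ μ * (i₀ + 2)`.
    obtain ⟨J, hJ⟩ := exists_nat_gt (μ * (i₀ + 2) / (μ - c))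
    rw [frequently_atTop]
    intro N
    obtain ⟨i₁, hi₁, hlt⟩ := hyinf.exists_gt (N + J + i₀)
    refine ⟨a i₁, (by omega : N ≤ i₁).trans ha.le_apply, ?_⟩
    have hcnt : Nat.count p (a i₁ + 1) = i₁ + 1 := Nat.count_nth_succ_of_infinite hinf i₁
    have h1 := cycleMean_le_sum_Ico hrun hu hρ ha (fun j => Nat.nth_mem_of_infinite hinf j)
      (fun j i hji hij hi => absurd (Nat.le_nth_of_lt_nth_succ hij hi) (not_le.2 hji))
      (by omega : i₀ < i₁) (hi₀.trans hi₁.symm)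
    have h2 : ∑ i ∈ Finset.Ico (a i₀) (a i₁), e (ρ i) ≤
        ∑ i ∈ Finset.range (a i₁ + 1), e (ρ i) := by
      refine Finset.sum_le_sum_of_subset_of_nonneg (fun i hi => ?_) fun i _ _ => hb.le.trans (he _)
      rw [Finset.mem_Ico] at hi
      rw [Finset.mem_range]; omega
    have h3 := hupper (a i₁)
    have h4 := hlower (a i₁)
    rw [hcnt] at h3 h4
    push_cast at h3 h4
    rw [div_lt_iff₀ (by linarith)] at hJ
    have h5 : (J : ℝ) ≤ i₁ := by exact_mod_cast (by omega : J ≤ i₁)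
    have h6 : (J : ℝ) * (μ - c) ≤ i₁ * (μ - c) := mul_le_mul_of_nonneg_right h5 (by linarith)
    have h7 := mul_le_mul_of_nonneg_left h3 hc0
    change μ * _ ≤ _ at h1
    nlinarith

theorem cycleMean_le_optValue [Finite X] (hrun : U.IsRunMap sur e run) {m : ℕ}
    {u : Fin (m + 1) → X} (hu : U.IsMinMeanCycle sur e run u) {b : ℝ} (hb : 0 < b)
    (he : ∀ x, b ≤ e x) (x : X) :
    ENNReal.ofReal (cycleMean e run u) ≤ U.optValue sur e x := by
  refine le_iInf₂ fun ρ hρ => le_of_forall_lt fun c hc => ?_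
  obtain ⟨d, hcd, hd⟩ := exists_between hc
  refine hcd.trans_le (le_limsup_of_frequently_le' ?_)
  have hdtop : d ≠ ⊤ := ne_top_of_lt hd
  have hd' : d.toReal < cycleMean e run u := (ENNReal.lt_ofReal_iff_toReal_lt hdtop).1 hd
  refine (frequently_mul_cycleCount_le hrun hu hb he hρ.2 ENNReal.toReal_nonneg hd').mono ?_
  intro n hn
  -- The count may vanish; a positive sum excludes the quotient 0/0.
  have hpos : 0 < ∑ i ∈ Finset.range (n + 1), e (ρ i) :=
    Finset.sum_pos (fun i _ => hb.trans_le (he _)) ⟨0, by simp⟩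
  rw [ENNReal.le_div_iff_mul_le (Or.inr (ENNReal.ofReal_pos.2 hpos).ne')
    (Or.inl (ENNReal.natCast_ne_top _))]
  conv_lhs => rw [← ENNReal.ofReal_toReal hdtop, ← ENNReal.ofReal_natCast]
  rw [← ENNReal.ofReal_mul ENNReal.toReal_nonneg]
  exact ENNReal.ofReal_le_ofReal hn

end SubSystem

end TS

/-! ### The optimal value is attained on the minimum mean cycle -/

/-- Along a run that eventually follows a cycle, sums of a state function and the number of
surveillance cycles both grow linearly. -/
theorem EventuallyFollows.sum_and_cycleCount {X AP : Type*} {P : TS X AP} (sur : AP) {ρ : ℕ → X}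
    {cyc : List X} (hρ : EventuallyFollows ρ cyc) (h : X → ℝ) :
    ∃ D, ∀ n : ℕ,
      ∑ i ∈ Finset.range (n + 1), h (ρ i) ≤ (cyc.map h).sum / cyc.length * (n + 1) + D ∧
      (cyc.map (P.surInd sur)).sum / cyc.length * (n + 1) - D ≤
        (P.cycleCount sur ((List.range (n + 1)).map ρ) : ℝ) := by
  obtain ⟨D₁, h₁⟩ := hρ.exists_abs_sum_sub_le h
  obtain ⟨D₂, h₂⟩ := hρ.exists_abs_sum_sub_le (P.surInd sur)
  have p₁ := (abs_nonneg _).trans (h₁ 0)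
  have p₂ := (abs_nonneg _).trans (h₂ 0)
  refine ⟨D₁ + D₂ + 1, fun n => ?_⟩
  have a₁ := abs_le.1 (h₁ (n + 1))
  have a₂ := abs_le.1 (h₂ (n + 1))
  push_cast at a₁ a₂
  have := P.cycleCount_map_range_lower sur ρ n
  constructor <;> linarith

namespace TS.SubSystem

variable {X AP : Type*} {P : TS X AP} {U : P.SubSystem} {sur : AP} {e : X → ℝ}
  {run : X → X → List X}

theorem cycleMean_nonneg (he : ∀ x, 0 ≤ e x) {m : ℕ} (u : Fin (m + 1) → X) :
    0 ≤ cycleMean e run u := by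
  unfold cycleMean
  refine div_nonneg (Finset.sum_nonneg fun i _ => List.sum_nonneg fun a ha => ?_) (by positivity)
  obtain ⟨x, _, rfl⟩ := List.mem_map.1 ha
  exact he x

theorem optValue_le_cycleMean (hU : U.StronglyConnected) (hrun : U.IsRunMap sur e run) {m : ℕ}
    {u : Fin (m + 1) → X} (hu : U.IsRedCycle sur u) (he : ∀ x, 0 ≤ e x) {x : X}
    (hx : x ∈ U.states) :
    U.optValue sur e x ≤ ENNReal.ofReal (cycleMean e run u) := by
  obtain ⟨ρ, h0, hρ, hfol⟩ := hU.exists_run_eventuallyFollows hrun hu hx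
  refine iInf₂_le_of_le ρ ⟨h0, hρ⟩ ?_
  obtain ⟨D, hD⟩ := hfol.sum_and_cycleCount (P := P) sur e
  have hL : (0 : ℝ) < (expandCycle run u).length := by exact_mod_cast hfol.length_pos
  rw [sum_expandCycle_eq_cycleMean, hrun.sum_surInd_expandCycle hu] at hD
  set L : ℝ := ((expandCycle run u).length : ℝ)
  set μ := cycleMean e run u
  have hμ : 0 ≤ μ := cycleMean_nonneg he u
  set N : ℕ → ℝ := fun n => (P.cycleCount sur ((List.range (n + 1)).map ρ) : ℝ)
  have hN : Tendsto N atTop atTop := by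
    have h1 : Tendsto (fun n : ℕ => ((m : ℝ) + 1) / L * ((n : ℝ) + 1) - D) atTop atTop := by
      refine tendsto_atTop_add_const_right _ _ (Tendsto.const_mul_atTop (by positivity) ?_)
      exact tendsto_atTop_add_const_right _ _ tendsto_natCast_atTop_atTop
    exact tendsto_atTop_mono (fun n => (hD n).2) h1
  -- By `hD` the sum is at most `μ * (N n + D) + D`; dividing by `N n` gives this bound.
  have hlim : Tendsto (fun n => ENNReal.ofReal (μ + (D + μ * D) / N n)) atTop
      (𝓝 (ENNReal.ofReal μ)) := by
    refine ENNReal.tendsto_ofReal ?_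
    simpa using (hN.const_div_atTop (D + μ * D)).const_add μ
  rw [← hlim.limsup_eq]
  refine limsup_le_limsup ?_
  filter_upwards [hN.eventually_gt_atTop 0] with n hn
  rw [← ENNReal.ofReal_natCast, ← ENNReal.ofReal_div_of_pos hn]
  refine ENNReal.ofReal_le_ofReal ?_
  rw [div_le_iff₀ hn, add_mul, div_mul_cancel₀ _ hn.ne']
  obtain ⟨h1, h2⟩ := hD n
  have h3 := mul_le_mul_of_nonneg_left h2 hμ
  have h4 : μ * (((m : ℝ) + 1) / L * ((n : ℝ) + 1) - D) =
    μ * (m + 1) / L * (n + 1) - μ * D := by ring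
  change _ ≤ μ * N n at h3
  linarith

theorem optValue_eq_cycleMean [Finite X] (hU : U.StronglyConnected)
    (hrun : U.IsRunMap sur e run) {m : ℕ} {u : Fin (m + 1) → X}
    (hu : U.IsMinMeanCycle sur e run u) {b : ℝ} (hb : 0 < b) (he : ∀ x, b ≤ e x) {x : X}
    (hx : x ∈ U.states) :
    U.optValue sur e x = ENNReal.ofReal (cycleMean e run u) :=
  le_antisymm (optValue_le_cycleMean hU hrun hu.1 (fun x => hb.le.trans (he x)) hx)
    (cycleMean_le_optValue hrun hu hb he x)

/-- An average strategy is constrained off its cycle only where the cycle is reachable. -/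
theorem StronglyConnected.minWeightTo_lt_top (hU : U.StronglyConnected) {x y : X}
    (hx : x ∈ U.states) (hy : y ∈ U.states) {A : Set X} (hyA : y ∈ A) :
    P.minWeightTo x A < ⊤ := by
  obtain ⟨l, hl, hlast⟩ := List.exists_isChain_cons_of_relationReflTransGen (hU x hx y hy)
  have hfin : P.IsFinRun (x :: l) := ⟨by simp, hl.imp fun _ _ => U.trans_T _ _⟩
  refine lt_of_le_of_lt (iInf₂_le_of_le y hyA (iInf₂_le (x :: l) ⟨hfin, rfl, ?_⟩))
    (ENat.natCast_lt_top (P.weight (x :: l)))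
  rw [List.getLast?_eq_some_getLast (by simp), hlast]

end TS.SubSystem

/-! ### The Markov chain of the penalty level -/

/-- The transition operator of the level of a penalty, acting on functions of the level. -/
noncomputable def levelStep (r : ℕ) (q : ℝ) (F : ℕ → ℝ) (y : ℕ) : ℝ :=
  if y < r then F (y + 1) else q * F r + (1 - q) * F 0

/-- The mean of a function of the level under the stationary law of the level. -/
noncomputable def levelMean (r : ℕ) (q : ℝ) (F : ℕ → ℝ) : ℝ :=
  ((1 - q) * ∑ y ∈ Finset.range r, F y + F r) / (r * (1 - q) + 1)

section LevelStep

variable {r : ℕ} {q : ℝ}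

/-- The stationary weights are `1 - q` on each level below `r` and 1 on `r`: every upward step and
the reset from `r` to 0 carry the same flow `1 - q`. -/
theorem levelMean_levelStep (F : ℕ → ℝ) :
    levelMean r q (levelStep r q F) = levelMean r q F := by
  unfold levelMean
  have h1 : ∑ y ∈ Finset.range r, levelStep r q F y = ∑ y ∈ Finset.range r, F (y + 1) :=
    Finset.sum_congr rfl fun y hy => if_pos (Finset.mem_range.1 hy)
  have h2 : levelStep r q F r = q * F r + (1 - q) * F 0 := if_neg (lt_irrefl r)
  have h3 := Finset.sum_range_succ F r
  rw [Finset.sum_range_succ'] at h3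
  rw [h1, h2]
  congr 1
  linear_combination (1 - q) * h3

theorem levelMean_iterate (F : ℕ → ℝ) (k : ℕ) :
    levelMean r q ((levelStep r q)^[k] F) = levelMean r q F := by
  induction k with
  | zero => rfl
  | succ k ih => rw [Function.iterate_succ_apply', levelMean_levelStep, ih]

theorem le_levelMean (hq : q ≤ 1) {F : ℕ → ℝ} {A : ℝ} (hF : ∀ y ≤ r, A ≤ F y) :
    A ≤ levelMean r q F := by
  have hq' : 0 ≤ 1 - q := by linarith
  rw [levelMean, le_div_iff₀ (by positivity)]
  have h1 : ∑ y ∈ Finset.range r, A ≤ ∑ y ∈ Finset.range r, F y :=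
    Finset.sum_le_sum fun y hy => hF y (Finset.mem_range.1 hy).le
  rw [Finset.sum_const, Finset.card_range, nsmul_eq_mul] at h1
  nlinarith [hF r le_rfl, mul_le_mul_of_nonneg_left h1 hq']

theorem levelMean_neg (F : ℕ → ℝ) :
    levelMean r q (fun y => - F y) = - levelMean r q F := by
  simp only [levelMean, Finset.sum_neg_distrib]
  ring

/-- With `levelMean_neg`, this turns lower bounds into upper bounds. -/
theorem levelStep_iterate_neg (F : ℕ → ℝ) (k : ℕ) :
    (levelStep r q)^[k] (fun y => - F y) = fun y => - (levelStep r q)^[k] F y := by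
  induction k with
  | zero => rfl
  | succ k ih =>
    rw [Function.iterate_succ_apply', ih, Function.iterate_succ_apply']
    funext y
    unfold levelStep
    split <;> ring

theorem le_levelStep_iterate (hq0 : 0 ≤ q) (hq : q ≤ 1) {F : ℕ → ℝ} {A : ℝ}
    (hF : ∀ y ≤ r, A ≤ F y) (k : ℕ) : ∀ y ≤ r, A ≤ (levelStep r q)^[k] F y := by
  induction k with
  | zero => exact hF
  | succ k ih =>
    intro y hy
    rw [Function.iterate_succ_apply', levelStep]
    split
    · exact ih _ (by omega)
    · nlinarith [ih r le_rfl, ih 0 (Nat.zero_le r)]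

/-- Doeblin minorization: the level climbs to `r` deterministically and then stays there with
probability `q` per step. So it is at `r` after `k` steps with probability at least `q ^ k`, and
there `F` exceeds `A` by `F r - A`. -/
theorem add_le_levelStep_iterate (hq0 : 0 ≤ q) (hq : q ≤ 1) {F : ℕ → ℝ} {A : ℝ}
    (hF : ∀ y ≤ r, A ≤ F y) (k : ℕ) :
    ∀ y ≤ r, r ≤ y + k → A + q ^ k * (F r - A) ≤ (levelStep r q)^[k] F y := by
  have hD : 0 ≤ F r - A := sub_nonneg.2 (hF r le_rfl)
  induction k with
  | zero =>
    intro y hy hy'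
    obtain rfl : y = r := by omega
    simp
  | succ k ih =>
    intro y hy hy'
    have hpow : 0 ≤ q ^ k * (F r - A) := by positivity
    rw [Function.iterate_succ_apply', levelStep, pow_succ]
    split
    · have := ih (y + 1) (by omega) (by omega)
      nlinarith
    · have h1 := ih r le_rfl (by omega)
      have h2 := le_levelStep_iterate hq0 hq hF k 0 (Nat.zero_le r)
      nlinarith [mul_le_mul_of_nonneg_left h1 hq0,
        mul_le_mul_of_nonneg_left h2 (sub_nonneg.2 hq)]

theorem levelStep_iterate_oscillation (hq0 : 0 ≤ q) (hq : q ≤ 1) (F : ℕ → ℝ) (A B : ℝ)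
    (hA : ∀ y ≤ r, A ≤ F y) (hB : ∀ y ≤ r, F y ≤ B) (k : ℕ) :
    ∃ A' B', (∀ y ≤ r, A' ≤ (levelStep r q)^[r * k] F y) ∧
      (∀ y ≤ r, (levelStep r q)^[r * k] F y ≤ B') ∧ B' - A' = (1 - q ^ r) ^ k * (B - A) := by
  induction k with
  | zero => exact ⟨A, B, hA, hB, by simp⟩
  | succ k ih =>
    obtain ⟨A', B', h1, h2, h3⟩ := ih
    set G := (levelStep r q)^[r * k] F with hG
    have hit : (levelStep r q)^[r * (k + 1)] F = (levelStep r q)^[r] G := by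
      rw [hG, ← Function.iterate_add_apply]
      congr 1
      rw [mul_add, mul_one, add_comm]
    -- After `r` further steps the minorization applies from every level. The two bounds approach
    -- each other by `q ^ r * (B' - A')` in total.
    refine ⟨A' + q ^ r * (G r - A'), B' - q ^ r * (B' - G r), fun y hy => ?_, fun y hy => ?_, ?_⟩
    · rw [hit]
      exact add_le_levelStep_iterate hq0 hq h1 r y hy (by omega)
    · have h4 := add_le_levelStep_iterate (F := fun y => - G y) (A := -B') hq0 hq
        (fun y hy => neg_le_neg (h2 y hy)) r y hy (by omega)
      rw [levelStep_iterate_neg] at h4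
      rw [hit]
      simp only at h4
      linarith
    · rw [pow_succ]
      linear_combination (1 - q ^ r) * h3

/-- The law of the level converges to its stationary law, uniformly in the initial level. -/
theorem exists_abs_levelStep_iterate_sub_le (hq0 : 0 < q) (hq : q ≤ 1) (F : ℕ → ℝ)
    (h0 : ∀ y ≤ r, 0 ≤ F y) (h1 : ∀ y ≤ r, F y ≤ 1) {δ : ℝ} (hδ : 0 < δ) :
    ∃ K, ∀ k ≥ K, ∀ y ≤ r, |(levelStep r q)^[k] F y - levelMean r q F| ≤ δ := by
  have hpow0 : 0 < q ^ r := by positivity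
  have hpow1 : q ^ r ≤ 1 := pow_le_one₀ hq0.le hq
  obtain ⟨n, hn⟩ := exists_pow_lt_of_lt_one hδ (by linarith : 1 - q ^ r < 1)
  obtain ⟨A, B, hA, hB, hAB⟩ := levelStep_iterate_oscillation hq0.le hq F 0 1 h0 h1 n
  refine ⟨r * n, fun k hk y hy => ?_⟩
  obtain ⟨j, rfl⟩ := Nat.exists_eq_add_of_le hk
  have hA' := le_levelStep_iterate hq0.le hq hA j
  have hB' := le_levelStep_iterate (F := fun y => - (levelStep r q)^[r * n] F y) (A := -B)
    hq0.le hq (fun y hy => neg_le_neg (hB y hy)) j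
  rw [levelStep_iterate_neg] at hB'
  rw [← Function.iterate_add_apply, add_comm] at hA' hB'
  -- The stationary mean is invariant under the iteration, so it lies between the same bounds as the
  -- iterates.
  have hmA := le_levelMean hq hA'
  have hmB := le_levelMean hq hB'
  rw [levelMean_neg, levelMean_iterate] at hmB
  rw [levelMean_iterate] at hmA
  have h2 := hA' y hy
  have h3 := hB' y hy
  simp only at h3
  rw [abs_le]
  constructor <;> linarith

/-- The stationary mean of the penalty. -/
noncomputable def meanPenalty (r : ℕ) (q : ℝ) : ℝ := levelMean r q fun y => (y : ℝ) / r

theorem meanPenalty_eq (hr : 0 < r) :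
    meanPenalty r q = ((1 - q) * (r - 1) / 2 + 1) / (r * (1 - q) + 1) := by
  have hr' : (r : ℝ) ≠ 0 := by positivity
  have h1 : ∑ y ∈ Finset.range r, ((y : ℝ) / r) = (r - 1) / 2 := by
    have h2 : ∀ n : ℕ, ∑ y ∈ Finset.range n, (y : ℝ) = n * (n - 1) / 2 := by
      intro n
      induction n with
      | zero => simp
      | succ n ih => rw [Finset.sum_range_succ, ih]; push_cast; ring
    rw [← Finset.sum_div, h2]
    field_simp
  rw [meanPenalty, levelMean, h1, div_self hr']
  ring

/-- The difference of the two sides is `r * (1 - q) * q / (2 * (r * (1 - q) + 1))`. -/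
theorem meanPenalty_lt (hr : 0 < r) (hq0 : 0 < q) (hq : q < 1) :
    meanPenalty r q < (1 + q) / 2 := by
  have hr' : (0 : ℝ) < r := by exact_mod_cast hr
  have h1 : 0 < 1 - q := sub_pos.2 hq
  have h2 : 0 < r * (1 - q) * q := by positivity
  rw [meanPenalty_eq hr, div_lt_div_iff₀ (by positivity) (by norm_num)]
  nlinarith

theorem meanPenalty_le (hr : 0 < r) (hq0 : 0 < q) (hq : q ≤ 1) :
    meanPenalty r q ≤ (1 + q) / 2 := by
  rcases hq.lt_or_eq with h | rfl
  · exact (meanPenalty_lt hr hq0 h).le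
  · rw [meanPenalty_eq hr]; norm_num

theorem meanPenalty_mem_Icc (hq : q ≤ 1) : meanPenalty r q ∈ Set.Icc (0 : ℝ) 1 := by
  refine ⟨le_levelMean hq fun y _ => by positivity, ?_⟩
  have h := le_levelMean (r := r) (F := fun y : ℕ => -((y : ℝ) / r)) (A := -1) hq fun y hy =>
    neg_le_neg (div_le_one_of_le₀ (by exact_mod_cast hy) (Nat.cast_nonneg r))
  rw [levelMean_neg] at h
  unfold meanPenalty
  linarith

end LevelStep

/-! ### Decay of correlations and a weak law of large numbers -/

section Coins

variable {S : Type*}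

/-- The law of the coins. -/
noncomputable def coinsLaw (p : S → Set.Ioc (0 : ℝ) 1) : Measure (S × ℕ → Bool) :=
  Measure.infinitePi fun i : S × ℕ => coinLaw (p i.1)

instance (p : S → Set.Ioc (0 : ℝ) 1) : IsProbabilityMeasure (coinsLaw p) := by
  unfold coinsLaw; infer_instance

theorem penaltyLevel_le {r : ℕ} (ω : PenaltySpace S r) (s : S) (t : ℕ) :
    penaltyLevel ω s t ≤ r := by
  induction t with
  | zero => exact Nat.lt_succ_iff.1 (ω.1 s).2
  | succ t ih =>
    rw [penaltyLevel]
    split_ifs <;> omega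

/-- Dependence on the coins before time `t` plays the role of measurability with respect to the
past. -/
theorem dependsOn_penaltyLevel {r : ℕ} (a : S → Fin (r + 1)) (s : S) (t : ℕ) :
    DependsOn (fun b : S × ℕ → Bool => penaltyLevel (a, b) s t) {i | i.2 < t} := by
  induction t with
  | zero => intro b b' _; rfl
  | succ t ih =>
    intro b b' h
    have h1 := ih (x := b) (y := b') fun i hi => h i (Nat.lt_succ_of_lt hi)
    have h2 := h (s, t) (Nat.lt_succ_self t)
    simp only [penaltyLevel] at h1 ⊢
    simp only [h1, h2]

/-- Finitely many coins are tossed before `t`, so `W` is measurable and takes finitely many values.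
-/
theorem integrable_of_dependsOn [Finite S] (p : S → Set.Ioc (0 : ℝ) 1)
    {W : (S × ℕ → Bool) → ℝ} {t : ℕ} (hW : DependsOn W {i | i.2 < t}) :
    Integrable W (coinsLaw p) := by
  have hfin : {i : S × ℕ | i.2 < t}.Finite :=
    (Set.finite_univ.prod (Set.finite_Iio t)).subset fun i hi => ⟨trivial, hi⟩
  have := hfin.to_subtype
  obtain ⟨g, rfl⟩ := dependsOn_iff_exists_comp.1 hW
  have hm : Measurable (Set.domRestrict (π := fun _ : S × ℕ => Bool) {i : S × ℕ | i.2 < t}) :=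
    measurable_pi_lambda _ fun i => measurable_pi_apply _
  obtain ⟨c, hc⟩ := (Set.finite_range fun x => ‖g x‖).bddAbove
  refine Integrable.of_bound ((measurable_of_finite g).comp hm).aestronglyMeasurable c ?_
  exact Eventually.of_forall fun b => hc ⟨_, rfl⟩

theorem integral_coin (q : Set.Ioc (0 : ℝ) 1) :
    ∫ c, (if c = true then (1 : ℝ) else 0) ∂coinLaw q = q := by
  have h0 := q.2.1
  have h1 := q.2.2
  rw [coinLaw, integral_add_measure, integral_smul_measure, integral_smul_measure,
    integral_dirac, integral_dirac]
  · simp [h0.le]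
  · exact (integrable_dirac (by simp)).smul_measure (by simp)
  · exact (integrable_dirac (by simp)).smul_measure (by simp)

theorem integral_coin_mul [Finite S] (p : S → Set.Ioc (0 : ℝ) 1) (s : S) {t : ℕ}
    {W : (S × ℕ → Bool) → ℝ} (hW : DependsOn W {i | i.2 < t}) :
    ∫ b, (if b (s, t) = true then (1 : ℝ) else 0) * W b ∂coinsLaw p =
      p s * ∫ b, W b ∂coinsLaw p := by
  have hint := integrable_of_dependsOn p hW
  have hfin : {i : S × ℕ | i.2 < t}.Finite :=
    (Set.finite_univ.prod (Set.finite_Iio t)).subset fun i hi => ⟨trivial, hi⟩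
  set I : Finset (S × ℕ) := hfin.toFinset
  have hW' : DependsOn W (I : Set (S × ℕ)) := by simpa [I] using hW
  obtain ⟨g, hg⟩ := dependsOn_iff_exists_comp.1 hW'
  have hind : ProbabilityTheory.iIndepFun (fun (i : S × ℕ) (b : S × ℕ → Bool) => b i)
      (coinsLaw p) :=
    ProbabilityTheory.iIndepFun_infinitePi (X := fun _ c => c) fun _ => measurable_id
  have h2 := hind.indepFun_finset {(s, t)} I (by simp [I]) fun i => measurable_pi_apply i
  have h3 := h2.comp
    (φ := fun c : (({(s, t)} : Finset (S × ℕ)) → Bool) =>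
      if c ⟨(s, t), by simp⟩ = true then (1 : ℝ) else 0) (ψ := g)
    (measurable_of_finite _) (measurable_of_finite _)
  have hmeas : Measurable fun c : Bool => if c = true then (1 : ℝ) else 0 := measurable_of_finite _
  have h4 := h3.integral_mul_eq_mul_integral
    (hmeas.comp (measurable_pi_apply (s, t))).aestronglyMeasurable
    (by have := hint.aestronglyMeasurable; rw [hg] at this; exact this)
  have h5 : ∫ b, (if b (s, t) = true then (1 : ℝ) else 0) ∂coinsLaw p = p s := by
    rw [← integral_coin (p s)]
    have hmap : (coinsLaw p).map (fun b => b (s, t)) = coinLaw (p s) :=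
      Measure.infinitePi_map_eval (fun i : S × ℕ => coinLaw (p i.1)) (s, t)
    rw [← hmap, integral_map (measurable_pi_apply _).aemeasurable hmeas.aestronglyMeasurable]
  rw [← h5, hg]
  exact h4

theorem DependsOn.mono_time {β : Type*} {W : (S × ℕ → Bool) → β} {t t' : ℕ}
    (hW : DependsOn W {i | i.2 < t}) (h : t ≤ t') : DependsOn W {i | i.2 < t'} :=
  fun _ _ hb => hW fun i hi => hb i (lt_of_lt_of_le hi h)

/-- The Markov property, tested against a function `W` of the past that may involve the coins of all
states. -/
theorem integral_level_succ_mul [Finite S] {r : ℕ} (p : S → Set.Ioc (0 : ℝ) 1)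
    (a : S → Fin (r + 1)) (s : S) (t : ℕ) {W : (S × ℕ → Bool) → ℝ}
    (hW : DependsOn W {i | i.2 < t}) (F : ℕ → ℝ) :
    ∫ b, F (penaltyLevel (a, b) s (t + 1)) * W b ∂coinsLaw p =
      ∫ b, levelStep r (p s) F (penaltyLevel (a, b) s t) * W b ∂coinsLaw p := by
  set Y : (S × ℕ → Bool) → ℕ := fun b => penaltyLevel (a, b) s t
  have hY : DependsOn Y {i | i.2 < t} := dependsOn_penaltyLevel a s t
  -- The product splits as `V` plus the coin times `Z`: `V` is its value if the coin is false, and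
  -- `Z` the change if it is true.
  let Z : (S × ℕ → Bool) → ℝ := fun b => if Y b < r then 0 else (F r - F 0) * W b
  let V : (S × ℕ → Bool) → ℝ := fun b => (if Y b < r then F (Y b + 1) else F 0) * W b
  have hZ : DependsOn Z {i | i.2 < t} := fun b b' h => by simp only [Z, hY h, hW h]
  have hV : DependsOn V {i | i.2 < t} := fun b b' h => by simp only [V, hY h, hW h]
  have hcZ : DependsOn (fun b => (if b (s, t) = true then (1 : ℝ) else 0) * Z b)
      {i | i.2 < t + 1} := fun b b' h => by
    simp only
    rw [hZ.mono_time (Nat.le_succ t) h, h (s, t) (Nat.lt_succ_self t)]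
  have h1 : ∀ b, F (penaltyLevel (a, b) s (t + 1)) * W b =
      V b + (if b (s, t) = true then (1 : ℝ) else 0) * Z b := by
    intro b
    simp only [penaltyLevel, V, Z, Y]
    split_ifs <;> ring
  have h2 : ∀ b, levelStep r (p s) F (penaltyLevel (a, b) s t) * W b = V b + (p s : ℝ) * Z b := by
    intro b
    simp only [levelStep, V, Z, Y]
    split_ifs <;> ring
  simp only [h1, h2]
  rw [integral_add (integrable_of_dependsOn p hV) (integrable_of_dependsOn p hcZ),
    integral_add (integrable_of_dependsOn p hV) ((integrable_of_dependsOn p hZ).const_mul _),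
    integral_coin_mul p s hZ, integral_const_mul]

theorem integral_level_add_mul [Finite S] {r : ℕ} (p : S → Set.Ioc (0 : ℝ) 1)
    (a : S → Fin (r + 1)) (s : S) (t k : ℕ) {W : (S × ℕ → Bool) → ℝ}
    (hW : DependsOn W {i | i.2 < t}) (F : ℕ → ℝ) :
    ∫ b, F (penaltyLevel (a, b) s (t + k)) * W b ∂coinsLaw p =
      ∫ b, (levelStep r (p s))^[k] F (penaltyLevel (a, b) s t) * W b ∂coinsLaw p := by
  induction k generalizing F with
  | zero => rfl
  | succ k ih =>
    rw [Function.iterate_succ_apply, ← ih, ← add_assoc,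
      integral_level_succ_mul p a s (t + k) (hW.mono_time (Nat.le_add_right t k))]

/-- The deviation of the penalty from its stationary mean. -/
noncomputable def penaltyDev {r : ℕ} (p : S → Set.Ioc (0 : ℝ) 1) (ω : PenaltySpace S r)
    (s : S) (t : ℕ) : ℝ :=
  penalty ω s t - meanPenalty r (p s)

theorem penalty_mem_Icc {r : ℕ} (ω : PenaltySpace S r) (s : S) (t : ℕ) :
    penalty ω s t ∈ Set.Icc (0 : ℝ) 1 := by
  refine ⟨by unfold penalty; positivity, div_le_one_of_le₀ ?_ (Nat.cast_nonneg r)⟩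
  exact_mod_cast penaltyLevel_le ω s t

theorem abs_penaltyDev_le {r : ℕ} (p : S → Set.Ioc (0 : ℝ) 1) (ω : PenaltySpace S r)
    (s : S) (t : ℕ) : |penaltyDev p ω s t| ≤ 1 := by
  have h1 := penalty_mem_Icc ω s t
  have h2 := meanPenalty_mem_Icc (r := r) (p s).2.2
  rw [abs_le, penaltyDev]
  constructor <;> linarith [h1.1, h1.2, h2.1, h2.2]

theorem dependsOn_penaltyDev {r : ℕ} (p : S → Set.Ioc (0 : ℝ) 1) (a : S → Fin (r + 1)) (s : S)
    (t : ℕ) : DependsOn (fun b : S × ℕ → Bool => penaltyDev p (a, b) s t) {i | i.2 < t} :=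
  fun b b' h => by
    have := dependsOn_penaltyLevel a s t h
    simp only [penaltyDev, penalty] at this ⊢
    rw [this]

/-- Correlations of penalties at distant times are uniformly small. -/
theorem exists_integral_penaltyDev_mul_le [Finite S] (r : ℕ) (p : S → Set.Ioc (0 : ℝ) 1)
    {δ : ℝ} (hδ : 0 < δ) :
    ∃ K, ∀ (a : S → Fin (r + 1)) (s s' : S) (t t' : ℕ), t' + K ≤ t →
      ∫ b, penaltyDev p (a, b) s t * penaltyDev p (a, b) s' t' ∂coinsLaw p ≤ δ := by
  have hex : ∀ s, ∃ K, ∀ k ≥ K, ∀ y ≤ r,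
      |(levelStep r (p s))^[k] (fun y => (y : ℝ) / r) y - meanPenalty r (p s)| ≤ δ := fun s =>
    exists_abs_levelStep_iterate_sub_le (p s).2.1 (p s).2.2 _ (fun y _ => by positivity)
      (fun y hy => div_le_one_of_le₀ (by exact_mod_cast hy) (Nat.cast_nonneg r)) hδ
  choose K hK using hex
  obtain ⟨K₀, hK₀⟩ := (Set.finite_range K).bddAbove
  refine ⟨K₀, fun a s s' t t' ht => ?_⟩
  obtain ⟨k, rfl⟩ := Nat.exists_eq_add_of_le (le_of_add_le_left ht)
  have hk : K s ≤ k := (hK₀ ⟨s, rfl⟩).trans (by omega)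
  set W : (S × ℕ → Bool) → ℝ := fun b => penaltyDev p (a, b) s' t'
  have hW : DependsOn W {i | i.2 < t'} := dependsOn_penaltyDev p a s' t'
  have hlev := dependsOn_penaltyLevel a s
  have hWi := (integrable_of_dependsOn p hW).const_mul (meanPenalty r (p s))
  -- Given the past up to `t'`, the later deviation is replaced by its `k`-step forecast, which is
  -- within `δ` of zero from every level.
  have h1 : ∫ b, penaltyDev p (a, b) s (t' + k) * W b ∂coinsLaw p =
      ∫ b, ((levelStep r (p s))^[k] (fun y => (y : ℝ) / r) (penaltyLevel (a, b) s t') -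
        meanPenalty r (p s)) * W b ∂coinsLaw p := by
    simp only [penaltyDev, sub_mul]
    rw [integral_sub _ hWi, integral_sub _ hWi]
    · congr 1
      exact integral_level_add_mul p a s t' k hW fun y => (y : ℝ) / r
    · refine integrable_of_dependsOn p (t := t') fun b b' h => ?_
      have h2 := hlev t' h
      have h3 := hW h
      simp only at h2 h3 ⊢
      rw [h2, h3]
    · refine integrable_of_dependsOn p (t := t' + k) fun b b' h => ?_
      have h2 := hlev (t' + k) h
      have h3 := hW.mono_time (Nat.le_add_right t' k) h
      simp only [penalty] at h2 h3 ⊢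
      rw [h2, h3]
  rw [h1]
  refine (le_abs_self _).trans ?_
  have h2 := norm_integral_le_of_norm_le_const (μ := coinsLaw p) (C := δ)
    (f := fun b => ((levelStep r (p s))^[k] (fun y => (y : ℝ) / r) (penaltyLevel (a, b) s t') -
        meanPenalty r (p s)) * W b) (Eventually.of_forall fun b => ?_)
  · simpa using h2
  · rw [norm_mul, Real.norm_eq_abs, Real.norm_eq_abs]
    have h3 := hK s k hk _ (penaltyLevel_le (a, b) s t')
    have h4 := abs_penaltyDev_le p (a, b) s' t'
    calc _ ≤ δ * 1 := mul_le_mul h3 h4 (abs_nonneg _) hδ.le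
      _ = δ := mul_one δ

/-- In each row of the expanded square at most `2 * K` pairs are close and contribute at most 1 more
than `δ`; all others contribute at most `δ`. A bound of order `δ * n ^ 2` is enough for Chebyshev's
inequality. -/
theorem exists_integral_sum_sq_le [Finite S] (r : ℕ) (p : S → Set.Ioc (0 : ℝ) 1)
    {δ : ℝ} (hδ : 0 < δ) :
    ∃ K : ℕ, ∀ (a : S → Fin (r + 1)) (s : ℕ → S) (t : ℕ → ℕ), StrictMono t → ∀ n : ℕ,
      ∫ b, (∑ i ∈ Finset.range n, penaltyDev p (a, b) (s i) (t i)) ^ 2 ∂coinsLaw p ≤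
        n * (n * δ + 2 * K) := by
  obtain ⟨K, hK⟩ := exists_integral_penaltyDev_mul_le r p hδ
  refine ⟨K, fun a s t ht n => ?_⟩
  set ξ : ℕ → (S × ℕ → Bool) → ℝ := fun i b => penaltyDev p (a, b) (s i) (t i)
  have hξ : ∀ i, DependsOn (ξ i) {j | j.2 < t i} := fun i => dependsOn_penaltyDev p a _ _
  have hint : ∀ i j, Integrable (fun b => ξ i b * ξ j b) (coinsLaw p) := by
    intro i j
    refine integrable_of_dependsOn p (t := max (t i) (t j)) fun b b' h => ?_
    rw [(hξ i).mono_time (le_max_left _ _) h, (hξ j).mono_time (le_max_right _ _) h]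
  have h1 : ∀ i j, ∫ b, ξ i b * ξ j b ∂coinsLaw p ≤ 1 := by
    intro i j
    refine (le_abs_self _).trans ?_
    have h2 := norm_integral_le_of_norm_le_const (μ := coinsLaw p) (C := 1)
      (f := fun b => ξ i b * ξ j b) (Eventually.of_forall fun b => ?_)
    · simpa using h2
    · rw [norm_mul, Real.norm_eq_abs, Real.norm_eq_abs]
      exact mul_le_one₀ (abs_penaltyDev_le p _ _ _) (abs_nonneg _) (abs_penaltyDev_le p _ _ _)
  -- The times are strictly increasing integers, so distant indices mean distant times.
  have hgap : ∀ i k, t i + k ≤ t (i + k) := by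
    intro i k
    induction k with
    | zero => simp
    | succ k ih =>
      have := ht (Nat.lt_succ_self (i + k))
      rw [← add_assoc]
      exact Nat.lt_of_le_of_lt ih this
  have hfar : ∀ i j, i + K ≤ j → ∫ b, ξ j b * ξ i b ∂coinsLaw p ≤ δ := by
    intro i j hij
    obtain ⟨k, rfl⟩ := Nat.exists_eq_add_of_le (le_of_add_le_left hij)
    exact hK a _ _ _ _ ((by omega : t i + K ≤ t i + k).trans (hgap i k))
  have hbound : ∀ i j, ∫ b, ξ i b * ξ j b ∂coinsLaw p ≤
      δ + if j ∈ Finset.Ico (i - K) (i + K) then 1 else 0 := by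
    intro i j
    split_ifs with hj
    · linarith [h1 i j]
    · rw [add_zero]
      rw [Finset.mem_Ico] at hj
      rcases Nat.lt_or_ge j (i + K) with h | h
      · exact hfar j i (by omega)
      · simp only [mul_comm (ξ i _)]
        exact hfar i j h
  have hexp : ∀ b, (∑ i ∈ Finset.range n, ξ i b) ^ 2 =
      ∑ i ∈ Finset.range n, ∑ j ∈ Finset.range n, ξ i b * ξ j b := by
    intro b
    rw [sq, Finset.sum_mul_sum]
  change ∫ b, (∑ i ∈ Finset.range n, ξ i b) ^ 2 ∂coinsLaw p ≤ _
  simp only [hexp]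
  rw [integral_finsetSum _ fun i _ => integrable_finsetSum _ fun j _ => hint i j]
  have hrow : ∀ i ∈ Finset.range n, ∫ b, ∑ j ∈ Finset.range n, ξ i b * ξ j b ∂coinsLaw p ≤
      n * δ + 2 * K := by
    intro i _
    rw [integral_finsetSum _ fun j _ => hint i j]
    refine (Finset.sum_le_sum fun j _ => hbound i j).trans ?_
    rw [Finset.sum_add_distrib, Finset.sum_const, Finset.card_range, nsmul_eq_mul]
    have hcard : ∑ j ∈ Finset.range n, (if j ∈ Finset.Ico (i - K) (i + K) then (1 : ℝ) else 0) ≤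
        2 * K := by
      rw [← Finset.sum_filter, Finset.sum_const, nsmul_eq_mul, mul_one]
      have : (Finset.filter (· ∈ Finset.Ico (i - K) (i + K)) (Finset.range n)).card ≤ 2 * K := by
        refine (Finset.card_le_card fun j hj => (Finset.mem_filter.1 hj).2).trans ?_
        rw [Nat.card_Ico]; omega
      exact_mod_cast this
    linarith
  refine (Finset.sum_le_sum hrow).trans ?_
  rw [Finset.sum_const, Finset.card_range, nsmul_eq_mul]

/-- A weak law of large numbers for penalties collected at increasing times. -/
theorem exists_penaltyLaw_sum_le [Finite S] (r : ℕ) (p : S → Set.Ioc (0 : ℝ) 1)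
    {η ε : ℝ} (hη : 0 < η) (hε : 0 < ε) :
    ∃ N : ℕ, ∀ (s : ℕ → S) (t : ℕ → ℕ), StrictMono t → ∀ n ≥ N,
      1 - ε ≤ (penaltyLaw r p).real
        {ω | ∑ i ∈ Finset.range n, penaltyDev p ω (s i) (t i) ≤ η * n} := by
  have : IsProbabilityMeasure (penaltyLaw r p) := by unfold penaltyLaw; infer_instance
  -- Chebyshev needs `n * (n * δ + 2 * K) ≤ ε * (η * n) ^ 2`: this `δ` uses half of the right side,
  -- and `N` makes the term with `K` fit into the other half.
  obtain ⟨K, hK⟩ := exists_integral_sum_sq_le r p (δ := ε * η ^ 2 / 2) (by positivity)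
  obtain ⟨N, hN⟩ := exists_nat_gt (4 * K / (ε * η ^ 2))
  refine ⟨N + 1, fun s t ht n hn => ?_⟩
  have hn0 : (0 : ℝ) < n := by exact_mod_cast (by omega : 0 < n)
  set X : PenaltySpace S r → ℝ := fun ω => ∑ i ∈ Finset.range n, penaltyDev p ω (s i) (t i)
  have hXm : Measurable X := Finset.measurable_sum _ fun i _ =>
    (measurable_penalty (s i) (t i)).sub_const _
  -- The initial levels are frozen. The bound is uniform in them, so integrating over their law
  -- preserves it.
  have hsec : ∀ a : S → Fin (r + 1),
      coinsLaw p (Prod.mk a ⁻¹' {ω | η * n < X ω}) ≤ ENNReal.ofReal ε := by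
    intro a
    have h1 : Measurable fun b => X (a, b) := hXm.comp measurable_prodMk_left
    have hbd : ∀ b, |X (a, b)| ≤ n := by
      intro b
      refine (Finset.abs_sum_le_sum_abs _ _).trans ?_
      refine (Finset.sum_le_sum fun i _ => abs_penaltyDev_le p (a, b) (s i) (t i)).trans ?_
      simp
    have hint : Integrable (fun b => X (a, b) ^ 2) (coinsLaw p) := by
      refine Integrable.of_bound (h1.pow_const 2).aestronglyMeasurable ((n : ℝ) ^ 2) ?_
      refine Eventually.of_forall fun b => ?_
      rw [norm_pow, Real.norm_eq_abs]
      exact pow_le_pow_left₀ (abs_nonneg _) (hbd b) 2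
    have h2 := mul_meas_ge_le_integral_of_nonneg (μ := coinsLaw p)
      (f := fun b => X (a, b) ^ 2) (Eventually.of_forall fun b => sq_nonneg _) hint ((η * n) ^ 2)
    have h3 := h2.trans (hK a s t ht n)
    have hsub : Prod.mk a ⁻¹' {ω | η * n < X ω} ⊆ {b | (η * n) ^ 2 ≤ X (a, b) ^ 2} := by
      intro b hb
      have hb' : η * n < X (a, b) := hb
      exact pow_le_pow_left₀ (a := η * n) (by positivity) hb'.le 2
    have h4 := measureReal_mono (μ := coinsLaw p) hsub
    rw [← ofReal_measureReal]
    refine ENNReal.ofReal_le_ofReal (h4.trans ?_)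
    have h5 : (N : ℝ) ≤ n := by exact_mod_cast (by omega : N ≤ n)
    rw [div_lt_iff₀ (by positivity)] at hN
    have h6 : 4 * (K : ℝ) ≤ n * (ε * η ^ 2) :=
      hN.le.trans (mul_le_mul_of_nonneg_right h5 (by positivity))
    have h7 : (n : ℝ) * (n * (ε * η ^ 2 / 2) + 2 * K) ≤ (η * n) ^ 2 * ε := by nlinarith
    exact le_of_mul_le_mul_left (h3.trans h7) (by positivity)
  have hbad : (penaltyLaw r p) {ω | η * n < X ω} ≤ ENNReal.ofReal ε := by
    have hms : MeasurableSet {ω | η * n < X ω} := measurableSet_lt measurable_const hXm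
    change ((Measure.infinitePi fun _ : S => (PMF.uniformOfFintype (Fin (r + 1))).toMeasure).prod
      (coinsLaw p)) _ ≤ _
    rw [Measure.prod_apply hms]
    refine (lintegral_mono hsec).trans ?_
    simp
  have hcompl : {ω | X ω ≤ η * n} = {ω | η * n < X ω}ᶜ := by
    ext ω; simp
  rw [hcompl, probReal_compl_eq_one_sub (measurableSet_lt measurable_const hXm)]
  have : (penaltyLaw r p).real {ω | η * n < X ω} ≤ ε :=
    ENNReal.toReal_le_of_le_ofReal hε.le hbad
  linarith

end Coins

/-! ### The average penalty under the strategy -/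

/-- If the stationary mean penalties collected on a cycle are less than `θ` per surveillance
cycle, then the average penalty is eventually at most `θ` with high probability. -/
theorem eventually_le_pathLaw_averagePenalty {S Q AP : Type*} [Finite S]
    {M : TS S AP} {B : Buchi Q AP} (sur : AP) (r : ℕ) (p : S → Set.Ioc (0 : ℝ) 1)
    {C : (M.product B).Strategy} {x : S × Q} {cyc : List (S × Q)}
    (hfol : EventuallyFollows (C.run x) cyc)
    (hsur : 0 < (cyc.map ((M.product B).surInd sur)).sum) {θ : ℝ} (hθ : 0 ≤ θ)
    (hmean : (cyc.map fun y => meanPenalty r (p y.1)).sum <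
      θ * (cyc.map ((M.product B).surInd sur)).sum) {ε : ℝ} (hε : 0 < ε) :
    ∀ᶠ n : ℕ in atTop, 1 - ε ≤ (pathLaw r p C x).real {κ | averagePenalty sur C x n κ ≤ θ} := by
  have : IsProbabilityMeasure (penaltyLaw r p) := by unfold penaltyLaw; infer_instance
  have hL : (0 : ℝ) < cyc.length := by exact_mod_cast hfol.length_pos
  obtain ⟨D, hD⟩ := hfol.sum_and_cycleCount (P := M.product B) sur
    fun y => meanPenalty r (p y.1)
  set G := (cyc.map fun y => meanPenalty r (p y.1)).sum
  set N := (cyc.map ((M.product B).surInd sur)).sum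
  set L : ℝ := (cyc.length : ℝ)
  -- Half of the gap per step, so that `G / L + 2 * η = θ * N / L`: one `η` covers the random
  -- fluctuation, the other absorbs the constants `D + θ * D`.
  set η := (θ * N - G) / L / 2 with hη
  have hη0 : 0 < η := by
    have : 0 < θ * N - G := sub_pos.2 hmean
    positivity
  obtain ⟨n₀, hn₀⟩ := exists_penaltyLaw_sum_le r p hη0 hε
  have hl1 : Tendsto (fun n : ℕ => η * ((n : ℝ) + 1)) atTop atTop :=
    (tendsto_atTop_add_const_right _ _ tendsto_natCast_atTop_atTop).const_mul_atTop hη0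
  have hl2 : Tendsto (fun n : ℕ => N / L * ((n : ℝ) + 1)) atTop atTop :=
    (tendsto_atTop_add_const_right _ _ tendsto_natCast_atTop_atTop).const_mul_atTop
      (by positivity)
  filter_upwards [eventually_ge_atTop n₀, hl1.eventually_ge_atTop (D + θ * D),
    hl2.eventually_gt_atTop D] with n hn h1 h2
  -- Weights are positive, so the penalties are read at strictly increasing times, as the weak law
  -- requires.
  refine (hn₀ (fun i => (C.run x i).1) _ (C.weight_pre_strictMono x) (n + 1) (by omega)).trans ?_
  have hmeas : MeasurableSet {κ : ℕ → ℝ | averagePenalty sur C x n κ ≤ θ} := by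
    refine measurableSet_le ?_ measurable_const
    exact (Finset.measurable_sum _ fun i _ => measurable_pi_apply i).div_const _
  rw [pathLaw, map_measureReal_apply (measurable_incurred C x) hmeas]
  refine measureReal_mono fun ω hω => ?_
  obtain ⟨h3, h4⟩ := hD n
  rw [← TS.Strategy.pre_eq_map_run] at h4
  have hpos : (0 : ℝ) < (M.product B).cycleCount sur (C.pre x n) := by linarith
  change (∑ i ∈ Finset.range (n + 1), incurred C x ω i) / _ ≤ θ
  rw [div_le_iff₀ hpos]
  have h5 : ∑ i ∈ Finset.range (n + 1), incurred C x ω i -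
      ∑ i ∈ Finset.range (n + 1), meanPenalty r (p (C.run x i).1) ≤ η * (n + 1 : ℕ) := by
    rw [← Finset.sum_sub_distrib]
    exact hω
  push_cast at h5
  have h6 := mul_le_mul_of_nonneg_left h4 hθ
  have h7 : θ * (N / L * ((n : ℝ) + 1) - D) =
      G / L * (n + 1) + 2 * (η * (n + 1)) - θ * D := by
    rw [hη]; field_simp; ring
  linarith

theorem tendsto_pathLaw_averagePenalty {S Q AP : Type*} [Finite S]
    {M : TS S AP} {B : Buchi Q AP} (sur : AP) (r : ℕ) (p : S → Set.Ioc (0 : ℝ) 1)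
    {C : (M.product B).Strategy} {x : S × Q} {cyc : List (S × Q)}
    (hfol : EventuallyFollows (C.run x) cyc)
    (hsur : 0 < (cyc.map ((M.product B).surInd sur)).sum) {θ : ℝ} (hθ : 0 ≤ θ)
    (hmean : (cyc.map fun y => meanPenalty r (p y.1)).sum <
      θ * (cyc.map ((M.product B).surInd sur)).sum) :
    Tendsto (fun n : ℕ => (pathLaw r p C x).real {κ | averagePenalty sur C x n κ ≤ θ})
      atTop (𝓝 1) := by
  refine tendsto_order.2 ⟨fun a ha => ?_, fun a ha => ?_⟩
  · filter_upwards [eventually_le_pathLaw_averagePenalty sur r p hfol hsur hθ hmean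
      (by linarith : 0 < (1 - a) / 2)] with n hn
    linarith
  · exact Eventually.of_forall fun n => lt_of_le_of_lt measureReal_le_one ha

theorem proposition1 {S Q AP : Type*} [Finite S] [Finite Q]
    (M : TS S AP) (B : Buchi Q AP) (sur : AP)
    (r : ℕ) (hr : 0 < r) (p : S → Set.Ioc (0 : ℝ) 1)
    (U : (M.product B).SubSystem) (hU : IsASCC U)
    (run : S × Q → S × Q → List (S × Q))
    (hrun : U.IsRunMap sur (fun x => penExp p x.1) run)
    {m : ℕ} (u : Fin (m + 1) → S × Q)
    (hu : U.IsMinMeanCycle sur (fun x => penExp p x.1) run u)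
    (C : (M.product B).Strategy) (hC : C.IsAverageStrategy (TS.expandCycle run u))
    (x : S × Q) (hx : x ∈ U.states) :
    U.optValue sur (fun y => penExp p y.1) x =
        ENNReal.ofReal (TS.cycleMean (fun y => penExp p y.1) run u) ∧
    (∀ ε : ℝ, 0 < ε →
      Tendsto (fun n : ℕ => (pathLaw r p C x).real
        {κ | averagePenalty sur C x n κ ≤
          (U.optValue sur (fun y => penExp p y.1) x).toReal + ε}) atTop (𝓝 1)) ∧
    ((∃ y ∈ TS.expandCycle run u, (p y.1 : ℝ) < 1) →
      Tendsto (fun n : ℕ => (pathLaw r p C x).real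
        {κ | averagePenalty sur C x n κ ≤
          (U.optValue sur (fun y => penExp p y.1) x).toReal}) atTop (𝓝 1)) ∧
    (∀ ε : ℝ, 0 < ε → ∃ j : ℕ, ∀ n : ℕ, j ≤ (M.product B).completed sur (C.pre x n) →
      1 - ε ≤ (pathLaw r p C x).real
        {κ | averagePenalty sur C x n κ ≤
          (U.optValue sur (fun y => penExp p y.1) x).toReal + ε}) := by
  have he : ∀ y : S × Q, (1 / 2 : ℝ) ≤ penExp p y.1 := fun y => by
    have := (p y.1).2.1
    unfold penExp; linarith
  have hopt := TS.SubSystem.optValue_eq_cycleMean hU.1.1 hrun hu one_half_pos he hx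
  have hμ0 : 0 ≤ TS.cycleMean (fun y => penExp p y.1) run u :=
    TS.SubSystem.cycleMean_nonneg (fun y => one_half_pos.le.trans (he y)) u
  rw [hopt, ENNReal.toReal_ofReal hμ0]
  obtain ⟨l, hl⟩ := hrun.exists_expandCycle_eq_cons hu.1
  have hfol := hC.eventuallyFollows x (hU.1.1.minWeightTo_lt_top hx (hu.1 0).left_mem.1
    (show u 0 ∈ TS.expandCycle run u by simp [hl]))
  have hsum := TS.SubSystem.sum_expandCycle_eq_cycleMean (fun y => penExp p y.1) run u
  have hN := hrun.sum_surInd_expandCycle hu.1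
  have hN0 : 0 < ((TS.expandCycle run u).map ((M.product B).surInd sur)).sum := by
    rw [hN]; positivity
  have hm1 : (0 : ℝ) < m + 1 := by positivity
  have hle : ∀ y : S × Q, meanPenalty r (p y.1) ≤ penExp p y.1 := fun y =>
    meanPenalty_le hr (p y.1).2.1 (p y.1).2.2
  have hmean : ∀ ε : ℝ, 0 < ε →
      ((TS.expandCycle run u).map fun y => meanPenalty r (p y.1)).sum <
        (TS.cycleMean (fun y => penExp p y.1) run u + ε) *
          ((TS.expandCycle run u).map ((M.product B).surInd sur)).sum := by
    intro ε hε
    have h1 := List.sum_le_sum (l := TS.expandCycle run u) fun y _ => hle y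
    rw [hN, add_mul, ← hsum]
    have := mul_pos hε hm1
    linarith
  refine ⟨rfl, fun ε hε => ?_, fun ⟨y, hy, hpy⟩ => ?_, fun ε hε => ?_⟩
  · exact tendsto_pathLaw_averagePenalty sur r p hfol hN0 (by linarith) (hmean ε hε)
  · refine tendsto_pathLaw_averagePenalty sur r p hfol hN0 hμ0 ?_
    rw [hN, ← hsum]
    -- A single state with `p < 1` on the cycle already gives the strict gap that ε provides in the
    -- other claims.
    exact List.sum_lt_sum _ _ (fun y _ => hle y) ⟨y, hy, meanPenalty_lt hr (p y.1).2.1 hpy⟩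
  · obtain ⟨j, hj⟩ := eventually_atTop.1 (eventually_le_pathLaw_averagePenalty sur r p hfol hN0
      (by linarith) (hmean ε hε) hε)
    refine ⟨j, fun n hn => hj n (hn.trans ?_)⟩
    rw [TS.Strategy.pre_eq_map_run]
    exact TS.completed_map_range_le _ _ _ _
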